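/- Let $d\ge 1$, let $V=\mathbb R^{d_\theta}$ carry a norm $\|\cdot\|$, let $\Theta\subseteq V$, and let $\theta_\star$ lie in the interior of $\Theta$. Let $\mu_\theta$ ($\theta\in\Theta$) and $\mu_\star$ be Borel probability measures on $\mathbb R^d$ with finite first moment, and let $X_1,X_2,\dots$ be random vectors in $\mathbb R^d$ on a probability space $(\Omega,\mathbb P)$ with empirical measures $\widehat\mu_n=\frac1n\sum_{i\le n}\delta_{X_i}$. Let $\mathcal W_1$ be the Wasserstein distance of order one, and let $$\mathcal{PW}(\mu,\nu)=\sup_{u\in S^{d-1}}\mathcal W_1(u_\#\mu,u_\#\nu),$$ where $u_\#\mu$ is the image of $\mu$ under $x\mapsto\langle u,x\rangle$ (the max-sliced Wasserstein distance, that is, $p=k=1$). For $u\in S^{d-1}$ and $t\in\mathbb R$ put $F_\theta(u,t)=\mu_\theta\{x:\langle u,x\rangle\le t\}$, $F_\star(u,t)=\mu_\star\{x:\langle u,x\rangle\le t\}$ and $\widehat F_n(u,t)=\frac1n\#\{i\le n:\langle u,X_i\rangle\le t\}$. For functions $f$ on $S^{d-1}\times\mathbb R$ let $\|f\|_L=\sup_u\int_{\mathbb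 R}|f(u,t)|\,dt$, and let $L$ be the space of $f$ whose slices $f(u,\cdot)$ are integrable and for which $\|f\|_L<\infty$, with the distance $\|f-g\|_L$. Assume: 1. $\mathcal W_1(\widehat\mu_n,\mu_\star)\to0$ almost surely. 2. $\theta\mapsto\mu_\theta$ is continuous on $\Theta$ for weak convergence. 3. For some $\tau>0$ the set $\{\theta\in\Theta:\mathcal{PW}(\mu_\star,\mu_\theta)\le\inf_{\theta'\in\Theta}\mathcal{PW}(\mu_\star,\mu_{\theta'})+\tau\}$ is bounded and its closure in $V$ is contained in $\Theta$ (the latter is automatic if $\Theta$ is closed). 4. $\theta_\star$ is the unique minimiser of $\theta\mapsto\mathcal{PW}(\mu_\star,\mu_\theta)$ over $\Theta$. 5. There is a measurable $D_\star:S^{d-1}\times\mathbb R\to V^*$ (with $V^*\cong\mathbb R^{d_\theta}$ and $\langle\cdot,\cdot\rangle$ the pairing) such that $\|F_\theta-F_{\theta_\star}-\langle\theta-\theta_\star,D_\star\rangle\|_L=o(\|\theta-\theta_\star\|)$ as $\theta\to\theta_\star$ in $\Theta$. 6. There is a random element $G_\star$ of $L$, defined on $\Omega$, such that $\sqrt n(\widehat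 F_n-F_\star)$ converges weakly in $L$ to $G_\star$. 7. There are a neighbourhood $\mathcal N\subseteq\Theta$ of $\theta_\star$ and $c_\star>0$ such that $\mathcal{PW}(\mu_\theta,\mu_\star)\ge\mathcal{PW}(\mu_{\theta_\star},\mu_\star)+c_\star\|\theta-\theta_\star\|$ for all $\theta\in\mathcal N$. Let $\eta_n>0$ be random variables with $\eta_n\to0$ almost surely, and put $$M_n=\Big\{\theta\in\Theta:\mathcal{PW}(\widehat\mu_n,\mu_\theta)\le\inf_{\theta'\in\Theta}\mathcal{PW}(\widehat\mu_n,\mu_{\theta'})+\eta_n/\sqrt n\Big\},$$ $$\mathcal N_1=\Big\{\theta\in\mathcal N:\|F_\theta-F_{\theta_\star}-\langle\theta-\theta_\star,D_\star\rangle\|_L\le\tfrac{c_\star}2\|\theta-\theta_\star\|\Big\},$$ $$K_n(x,\beta)=\Big\{\theta\in\mathcal N_1:\|x-\sqrt n\langle\theta-\theta_\star,D_\star\rangle\|_L\le\inf_{\theta'\in\mathcal N_1}\|x-\sqrt n\langle\theta'-\theta_\star,D_\star\rangle\|_L+\beta\Big\},$$ $G_n=\sqrt n(\widehat F_n-F_{\theta_\star})$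 and $G_n^\star=G_\star+\sqrt n(F_\star-F_{\theta_\star})$. Write $\mathbb P_*$ for inner probability. Then there is a deterministic sequence $\beta_n\ge0$ with $\beta_n\to0$ such that, as $n\to\infty$: (a) $\mathbb P_*\big(M_n\subseteq K_n(G_n,\beta_n)\big)\to1$. (b) With inner probability tending to $1$, the sets $K_n(G_n^\star,0)$ and $K_n(G_n,\beta_n)$ are nonempty, compact and convex; and for every $\epsilon>0$, $\mathbb P_*\big(d_H(K_n(G_n^\star,0),K_n(G_n,\beta_n))<\epsilon\big)\to1$. Here the same event may be required simultaneously for the Hausdorff distance $d_H$ of the norm of $V$ and for the Hausdorff distance of $\|\cdot\|_L$ between the images of the two sets under $\theta\mapsto\langle\theta-\theta_\star,D_\star\rangle\in L$. (c) The rate is $n^{-1/2}$: for every $\delta>0$ there is $C$ such that for all large $n$, with inner probability at least $1-\delta$, every $\theta\in M_n$ satisfies $\|\theta-\theta_\star\|\le C/\sqrt n$, and $d_H(K_n(G_n^\star,0),K_n(G_n,\beta_n))\le C/\sqrt n$ for the norm of $V$. -/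

import Mathlib

open MeasureTheory Filter Topology
open scoped ENNReal NNReal

namespace MaxSliced

noncomputable section

/-- `ℝ^d` with its Euclidean norm. -/
abbrev Space (d : ℕ) : Type := EuclideanSpace ℝ (Fin d)

/-- The unit sphere `S^{d-1}` of `ℝ^d`. -/
abbrev USphere (d : ℕ) : Type := Metric.sphere (0 : Space d) 1

/-- The Wasserstein distance of order one, as an infimum over couplings. -/
def wasserstein {E : Type*} [PseudoEMetricSpace E] [MeasurableSpace E] (μ ν : Measure E) : ℝ≥0∞ :=
  ⨅ (π : Measure (E × E)) (_ : π.map Prod.fst = μ ∧ π.map Prod.snd = ν),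
    ∫⁻ z, edist z.1 z.2 ∂π

/-- The projection robust Wasserstein distance with `p = k = 1` (max-sliced Wasserstein): a
`d × 1` matrix with orthonormal columns is a unit vector `u`, and its projection is
`x ↦ ⟪u, x⟫`. -/
def maxSW {d : ℕ} (μ ν : Measure (Space d)) : ℝ≥0∞ :=
  ⨆ u : USphere d, wasserstein (μ.map fun x => inner ℝ (u : Space d) x)
    (ν.map fun x => inner ℝ (u : Space d) x)

/-- The empirical measure of the first `n` points of a sequence. -/
def empMeasure {d : ℕ} (x : ℕ → Space d) (n : ℕ) : Measure (Space d) :=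
  (n : ℝ≥0∞)⁻¹ • ∑ i ∈ Finset.range n, Measure.dirac (x i)

/-- `(u, t) ↦ μ {x | ⟪u, x⟫ ≤ t}`. -/
def projCDF {d : ℕ} (μ : Measure (Space d)) (u : USphere d) (t : ℝ) : ℝ :=
  μ.real {x | inner ℝ (u : Space d) x ≤ t}

open Classical in
/-- `(u, t) ↦ (1/n) #{i < n | ⟪u, x i⟫ ≤ t}`. -/
def empCDF {d : ℕ} (x : ℕ → Space d) (n : ℕ) (u : USphere d) (t : ℝ) : ℝ :=
  (1 / (n : ℝ)) * (((Finset.range n).filter fun i => inner ℝ (u : Space d) (x i) ≤ t).card : ℝ)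

/-- `‖f‖_L = sup_u ∫ |f(u, t)| dt`, with values in `[0, ∞]`. -/
def normL {d : ℕ} (f : USphere d → ℝ → ℝ) : ℝ≥0∞ := ⨆ u, ∫⁻ t, ‖f u t‖ₑ

/-- The functions on `S^{d-1} × ℝ` with integrable slices `f(u, ·)` and `‖f‖_L < ∞`. -/
def LSpace (d : ℕ) : Type :=
  {f : USphere d → ℝ → ℝ // (∀ u, Integrable (f u)) ∧ normL f < ∞}

/-- The (pseudo-)distance `‖f - g‖_L`. -/
instance (d : ℕ) : PseudoEMetricSpace (LSpace d) where
  edist f g := normL (f.1 - g.1)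
  edist_self f := by simp [normL]
  edist_comm f g := by
    simp only [normL, Pi.sub_apply]
    exact iSup_congr fun u => lintegral_congr fun t => by rw [← enorm_neg, neg_sub]
  edist_triangle f g h := by
    simp only [normL, Pi.sub_apply]
    refine iSup_le fun u => ?_
    calc ∫⁻ t, ‖f.1 u t - h.1 u t‖ₑ
        ≤ ∫⁻ t, (‖f.1 u t - g.1 u t‖ₑ + ‖g.1 u t - h.1 u t‖ₑ) :=
          lintegral_mono fun t => by
            rw [← sub_add_sub_cancel (f.1 u t) (g.1 u t) (h.1 u t)]
            exact enorm_add_le _ _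
      _ = (∫⁻ t, ‖f.1 u t - g.1 u t‖ₑ) + ∫⁻ t, ‖g.1 u t - h.1 u t‖ₑ :=
          lintegral_add_left' ((f.2.1 u).sub (g.2.1 u)).aestronglyMeasurable.enorm _
      _ ≤ _ := add_le_add (le_iSup (fun u => ∫⁻ t, ‖f.1 u t - g.1 u t‖ₑ) u)
          (le_iSup (fun u => ∫⁻ t, ‖g.1 u t - h.1 u t‖ₑ) u)

instance (d : ℕ) : MeasurableSpace (LSpace d) := borel _

instance (d : ℕ) : BorelSpace (LSpace d) := ⟨rfl⟩

lemma lintegral_step_sub (a b : ℝ) :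
    ∫⁻ t, ‖(if a ≤ t then (1 : ℝ) else 0) - (if b ≤ t then 1 else 0)‖ₑ ≤ ‖a - b‖ₑ := by
  calc ∫⁻ t, ‖(if a ≤ t then (1 : ℝ) else 0) - (if b ≤ t then 1 else 0)‖ₑ
      ≤ ∫⁻ t, (Set.Ico (min a b) (max a b)).indicator 1 t := by
        refine lintegral_mono fun t => ?_
        by_cases h1 : a ≤ t <;> by_cases h2 : b ≤ t <;>
          simp [h1, h2, Set.indicator, not_le.mp]
    _ = volume (Set.Ico (min a b) (max a b)) := lintegral_indicator_one measurableSet_Ico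
    _ = ‖a - b‖ₑ := by
        rw [Real.volume_Ico, max_sub_min_eq_abs', Real.enorm_eq_ofReal_abs]

lemma measurable_projCDF {d : ℕ} (μ : Measure (Space d)) [IsProbabilityMeasure μ]
    (u : USphere d) : Measurable (projCDF μ u) := by
  have : Monotone (projCDF μ u) := fun s t h =>
    measureReal_mono (fun x (hx : _ ≤ s) => le_trans hx h)
  exact this.measurable

lemma lintegral_step_sub_projCDF {d : ℕ} (μ : Measure (Space d)) [IsProbabilityMeasure μ]
    (u : USphere d) (x : Space d) :
    ∫⁻ t, ‖(if inner ℝ (u : Space d) x ≤ t then (1 : ℝ) else 0) - projCDF μ u t‖ₑ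
      ≤ ‖x‖ₑ + ∫⁻ y, ‖y‖ₑ ∂μ := by
  set a : ℝ := inner ℝ (u : Space d) x with ha
  have hm (t : ℝ) : MeasurableSet {y : Space d | inner ℝ (u : Space d) y ≤ t} :=
    measurableSet_le (by fun_prop) measurable_const
  have key (t : ℝ) : (if a ≤ t then (1 : ℝ) else 0) - projCDF μ u t
      = ∫ y, ((if a ≤ t then (1 : ℝ) else 0)
          - (if inner ℝ (u : Space d) y ≤ t then 1 else 0)) ∂μ := by
    have hi : (fun y : Space d => if inner ℝ (u : Space d) y ≤ t then (1 : ℝ) else 0)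
        = {y : Space d | inner ℝ (u : Space d) y ≤ t}.indicator 1 := by
      ext y; simp [Set.indicator]
    rw [integral_sub (integrable_const _), hi, integral_indicator_one (hm t)]
    · simp [projCDF]
    · rw [hi]; exact (integrable_const (1 : ℝ)).indicator (hm t)
  have hmeas : Measurable (Function.uncurry fun (t : ℝ) (y : Space d) =>
      ‖(if a ≤ t then (1 : ℝ) else 0) - (if inner ℝ (u : Space d) y ≤ t then 1 else 0)‖ₑ) := by
    refine Measurable.enorm (Measurable.sub ?_ ?_)
    · exact Measurable.ite (measurableSet_le measurable_const measurable_fst)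
        measurable_const measurable_const
    · exact Measurable.ite (measurableSet_le (by fun_prop) measurable_fst)
        measurable_const measurable_const
  have hn (y : Space d) : ‖(inner ℝ (u : Space d) y : ℝ)‖ₑ ≤ ‖y‖ₑ := by
    have h1 : ‖(u : Space d)‖ = 1 := by simp
    have h2 := norm_inner_le_norm (𝕜 := ℝ) (u : Space d) y
    rw [h1, one_mul] at h2
    exact enorm_le_iff_norm_le.mpr h2
  calc ∫⁻ t, ‖(if a ≤ t then (1 : ℝ) else 0) - projCDF μ u t‖ₑ
      ≤ ∫⁻ t, ∫⁻ y, ‖(if a ≤ t then (1 : ℝ) else 0)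
          - (if inner ℝ (u : Space d) y ≤ t then 1 else 0)‖ₑ ∂μ :=
        lintegral_mono fun t => by rw [key t]; exact enorm_integral_le_lintegral_enorm _
    _ = ∫⁻ y, ∫⁻ t, ‖(if a ≤ t then (1 : ℝ) else 0)
          - (if inner ℝ (u : Space d) y ≤ t then 1 else 0)‖ₑ ∂volume ∂μ :=
        lintegral_lintegral_swap hmeas.aemeasurable
    _ ≤ ∫⁻ y, (‖x‖ₑ + ‖y‖ₑ) ∂μ := lintegral_mono fun y =>
        (lintegral_step_sub _ _).trans ((enorm_sub_le).trans (add_le_add (hn x) (hn y)))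
    _ = ‖x‖ₑ + ∫⁻ y, ‖y‖ₑ ∂μ := by
        rw [lintegral_add_left measurable_const]; simp

lemma empProcess_mem {d : ℕ} (μ : Measure (Space d)) [IsProbabilityMeasure μ]
    (hμ : Integrable (fun y => ‖y‖) μ) (x : ℕ → Space d) (n : ℕ) :
    (∀ u, Integrable fun t => √(n : ℝ) * (empCDF x n u t - projCDF μ u t)) ∧
      normL (fun u t => √(n : ℝ) * (empCDF x n u t - projCDF μ u t)) < ∞ := by
  rcases Nat.eq_zero_or_pos n with rfl | hn
  · simp [normL]
  have hfin : ∫⁻ y, ‖y‖ₑ ∂μ < ∞ := by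
    have := hμ.hasFiniteIntegral
    simpa [HasFiniteIntegral] using this
  have hn' : (n : ℝ) ≠ 0 := by positivity
  set B : ℝ≥0∞ := ‖√(n : ℝ) * (1 / n)‖ₑ * ∑ i ∈ Finset.range n, (‖x i‖ₑ + ∫⁻ y, ‖y‖ₑ ∂μ) with hB
  have hBfin : B < ∞ := by
    refine ENNReal.mul_lt_top enorm_lt_top (ENNReal.sum_lt_top.mpr fun i _ => ?_)
    exact ENNReal.add_lt_top.mpr ⟨enorm_lt_top, hfin⟩
  have hstep (u : USphere d) (i : ℕ) : Measurable fun t : ℝ =>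
      (if inner ℝ (u : Space d) (x i) ≤ t then (1 : ℝ) else 0) - projCDF μ u t :=
    (Measurable.ite measurableSet_Ici measurable_const measurable_const).sub
      (measurable_projCDF μ u)
  have heq (u : USphere d) : (fun t => √(n : ℝ) * (empCDF x n u t - projCDF μ u t))
      = fun t => √(n : ℝ) * (1 / n) * ∑ i ∈ Finset.range n,
        ((if inner ℝ (u : Space d) (x i) ≤ t then (1 : ℝ) else 0) - projCDF μ u t) := by
    ext t
    rw [Finset.sum_sub_distrib, Finset.sum_boole, empCDF]
    simp only [Finset.sum_const, Finset.card_range, nsmul_eq_mul]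
    field_simp
  have hbound (u : USphere d) :
      ∫⁻ t, ‖√(n : ℝ) * (empCDF x n u t - projCDF μ u t)‖ₑ ≤ B := by
    have h1 (t : ℝ) : ‖√(n : ℝ) * (empCDF x n u t - projCDF μ u t)‖ₑ
        ≤ ‖√(n : ℝ) * (1 / n)‖ₑ * ∑ i ∈ Finset.range n,
          ‖(if inner ℝ (u : Space d) (x i) ≤ t then (1 : ℝ) else 0) - projCDF μ u t‖ₑ := by
      rw [congrFun (heq u) t, enorm_mul]
      gcongr
      exact enorm_sum_le _ _
    refine (lintegral_mono h1).trans ?_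
    rw [lintegral_const_mul _ (Finset.measurable_sum _ fun i _ => (hstep u i).enorm),
      lintegral_finsetSum _ fun i _ => (hstep u i).enorm]
    rw [hB]
    gcongr with i _
    exact lintegral_step_sub_projCDF μ u (x i)
  refine ⟨fun u => ⟨?_, (hbound u).trans_lt hBfin⟩, (iSup_le hbound).trans_lt hBfin⟩
  rw [heq u]
  exact ((Finset.measurable_sum _ fun i _ => hstep u i).const_mul _).aestronglyMeasurable

/-- The empirical process `√n (F̂_n - F_μ)` as an element of `LSpace d`. -/
def empProcess {d : ℕ} (μ : Measure (Space d)) [IsProbabilityMeasure μ]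
    (hμ : Integrable (fun y => ‖y‖) μ) (x : ℕ → Space d) (n : ℕ) : LSpace d :=
  ⟨fun u t => √(n : ℝ) * (empCDF x n u t - projCDF μ u t), empProcess_mem μ hμ x n⟩

/-- The inner probability of an arbitrary event. -/
def innerProb {Ω : Type*} [MeasurableSpace Ω] (P : Measure Ω) (A : Set Ω) : ℝ≥0∞ :=
  ⨆ (B : Set Ω) (_ : MeasurableSet B ∧ B ⊆ A), P B

section Model

variable {d : ℕ} {V : Type*} [NormedAddCommGroup V] [NormedSpace ℝ V]

/-- The remainder `F_θ - F_{θ⋆} - ⟨θ - θ⋆, D⟩`. -/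
def remainder (μ : V → ProbabilityMeasure (Space d)) (θs : V)
    (D : USphere d → ℝ → StrongDual ℝ V) (θ : V) : USphere d → ℝ → ℝ := fun u t =>
  projCDF (μ θ : Measure (Space d)) u t - projCDF (μ θs : Measure (Space d)) u t
    - D u t (θ - θs)

/-- The local set `𝒩₁ = {θ ∈ 𝒩 | ‖F_θ - F_{θ⋆} - ⟨θ - θ⋆, D⟩‖_L ≤ (c/2) ‖θ - θ⋆‖}`. -/
def localSet (μ : V → ProbabilityMeasure (Space d)) (θs : V)
    (D : USphere d → ℝ → StrongDual ℝ V) (N : Set V) (c : ℝ) : Set V :=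
  {θ | θ ∈ N ∧ normL (remainder μ θs D θ) ≤ ENNReal.ofReal (c / 2 * ‖θ - θs‖)}

/-- The function `x - √n ⟨θ - θ⋆, D⟩`. -/
def linResidual (D : USphere d → ℝ → StrongDual ℝ V) (θs : V) (n : ℕ)
    (x : USphere d → ℝ → ℝ) (θ : V) : USphere d → ℝ → ℝ := fun u t =>
  x u t - √(n : ℝ) * D u t (θ - θs)

/-- The set `K(x, β)` (at sample size `n`) of `β`-approximate minimisers over `N₁` of
`θ ↦ ‖x - √n ⟨θ - θ⋆, D⟩‖_L`. -/
def nearArgmin (D : USphere d → ℝ → StrongDual ℝ V) (θs : V) (N₁ : Set V) (n : ℕ)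
    (x : USphere d → ℝ → ℝ) (β : ℝ≥0) : Set V :=
  {θ | θ ∈ N₁ ∧ normL (linResidual D θs n x θ)
    ≤ (⨅ θ' ∈ N₁, normL (linResidual D θs n x θ')) + β}

/-- The image in `LSpace d` of a set of parameters under `θ ↦ ⟨θ - θ⋆, D⟩`. -/
def linImage (D : USphere d → ℝ → StrongDual ℝ V) (θs : V) (K : Set V) : Set (LSpace d) :=
  {f | ∃ θ ∈ K, ∀ u t, f.1 u t = D u t (θ - θs)}

/-- `G_n = √n (F̂_n - F_{θ⋆})`, for the data `x`. -/
def empG (μ : V → ProbabilityMeasure (Space d)) (θs : V) (x : ℕ → Space d) (n : ℕ) :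
    USphere d → ℝ → ℝ := fun u t =>
  √(n : ℝ) * (empCDF x n u t - projCDF (μ θs : Measure (Space d)) u t)

/-- `G_n⋆ = G⋆ + √n (F⋆ - F_{θ⋆})`, for a realisation `g` of `G⋆`. -/
def limG (μ : V → ProbabilityMeasure (Space d)) (θs : V)
    (μs : ProbabilityMeasure (Space d)) (g : LSpace d) (n : ℕ) :
    USphere d → ℝ → ℝ := fun u t =>
  g.1 u t + √(n : ℝ) * (projCDF (μs : Measure (Space d)) u t
    - projCDF (μ θs : Measure (Space d)) u t)

/-- The set `M_n` of approximate minimum max-sliced Wasserstein estimators, with tolerance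
`e / √n`, for the data `x`. -/
def approxEstimators (Θ : Set V) (μ : V → ProbabilityMeasure (Space d)) (x : ℕ → Space d)
    (n : ℕ) (e : ℝ) : Set V :=
  {θ | θ ∈ Θ ∧ maxSW (empMeasure x n) (μ θ) ≤
    (⨅ θ' ∈ Θ, maxSW (empMeasure x n) (μ θ')) + ENNReal.ofReal (e / √(n : ℝ))}

/-- The set `Θ⋆(τ)` of `τ`-approximate minimisers of the population criterion. -/
def popNearArgmin (Θ : Set V) (μ : V → ProbabilityMeasure (Space d))
    (μs : ProbabilityMeasure (Space d)) (τ : ℝ) : Set V :=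
  {θ | θ ∈ Θ ∧ maxSW (μs : Measure (Space d)) (μ θ) ≤
    (⨅ θ' ∈ Θ, maxSW (μs : Measure (Space d)) (μ θ')) + ENNReal.ofReal τ}

end Model

end

end MaxSliced

/-! On the line, `W₁` is the `L¹` distance of distribution functions
(`wasserstein_eq_lintegral_cdf`), so the max-sliced distance is a distance in the seminormed space
`L` (`maxSW_eq_normL`). Put `φ θ = F_θ - F_{θs}`, `A v = ⟨v, D⟩`, `a = F⋆ - F_{θs}`, `z = √n (F̂_n -
F⋆)` and `s = √n`. The rescaled criterion is `‖z + s • a - s • φ θ‖`, and the surrogate replaces `φ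
θ` by `A (θ - θs)`.

Strong identifiability makes `‖φ θ - a‖` exceed `‖a‖` by `c * ‖θ - θs‖`; on `N₁` the linearised
version keeps slope `c / 2`. After scaling the slope is of order `s`, whereas a perturbation with
`‖z‖ ≤ R` can offset at most `2 * R`. Hence, once `n` is large, all near-minimisers lie in a ball
about `θs` of radius `O(1 / s)`. This gives the rate. It also gives the Hausdorff convergence, since
two nonempty subsets of a small ball are close: no finer comparison of the two near-argmin sets, or
of `z` with `G⋆`, is needed. Compactness and convexity hold because the ball lies inside `N₁`. On a
ball of radius `O(1 / s)` the linearisation error, multiplied by `s`, is `o(1)`; this gives the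
inclusion in (a) (`mem_linArgmin_of_near_min`).

These statements are deterministic and uniform over `‖z‖ ≤ R`. Global near-minimisers enter `N`
because the population criterion is lower semicontinuous with a unique minimiser
(`exists_maxSW_le_imp_mem`). Probability enters through tightness
(`exists_forall_eventually_le_measure`), and a diagonal choice produces `β_n`. -/

namespace MaxSliced

/-! ### Perturbed norm minimisation in a seminormed space -/

section Deterministic

/-- The rate of convergence of approximate minimisers of the distance to `φ θ`. -/
lemma norm_sub_le_of_near_min {V E : Type*} [NormedAddCommGroup V]
    [SeminormedAddCommGroup E] [NormedSpace ℝ E] {θs : V} {a z : E} {s R : ℝ}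
    {φ : V → E} {c η : ℝ} (hc : 0 < c) (hs : 0 < s)
    (hφ : φ θs = 0) {θ : V} (hid : ‖a‖ + c * ‖θ - θs‖ ≤ ‖φ θ - a‖) (hz : ‖z‖ ≤ R) (hη : η ≤ 1)
    (h : ‖z + s • a - s • φ θ‖ ≤ ‖z + s • a - s • φ θs‖ + η) :
    ‖θ - θs‖ ≤ (2 * R + 1) / (c * s) := by
  have h1 : ‖s • (φ θ - a)‖ ≤ ‖z + s • a - s • φ θ‖ + ‖z‖ := by
    rw [← norm_neg (s • (φ θ - a))]
    have := norm_sub_le (z + s • a - s • φ θ) z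
    rwa [show z + s • a - s • φ θ - z = -(s • (φ θ - a)) by rw [smul_sub]; abel] at this
  have h2 : ‖z + s • a‖ ≤ ‖z‖ + s * ‖a‖ := by
    refine (norm_add_le _ _).trans ?_
    rw [norm_smul, Real.norm_of_nonneg hs.le]
  rw [norm_smul, Real.norm_of_nonneg hs.le] at h1
  rw [hφ, smul_zero, sub_zero] at h
  -- The terms `s * ‖a‖` cancel, which leaves `c * s * ‖θ - θs‖ ≤ 2 * ‖z‖ + η`.
  rw [le_div_iff₀ (by positivity)]
  nlinarith [mul_le_mul_of_nonneg_left hid hs.le]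

variable {V E : Type*} [NormedAddCommGroup V] [NormedSpace ℝ V]
  [SeminormedAddCommGroup E] [NormedSpace ℝ E]

/-- The criterion `‖x - s A (θ - θs)‖` grows linearly away from `θs`, up to the size of the
perturbation `z` of `x = z + s a`. -/
lemma le_norm_perturbed_sub (A : V →L[ℝ] E) (θs : V) (a z : E) {s κ : ℝ} (hs : 0 ≤ s) {θ : V}
    (h : ‖a‖ + κ * ‖θ - θs‖ ≤ ‖a - A (θ - θs)‖) :
    ‖z + s • a‖ + s * κ * ‖θ - θs‖ - 2 * ‖z‖ ≤ ‖z + s • a - s • A (θ - θs)‖ := by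
  have h1 : ‖s • (a - A (θ - θs))‖ ≤ ‖z + s • a - s • A (θ - θs)‖ + ‖z‖ := by
    have := norm_sub_le (z + s • a - s • A (θ - θs)) z
    rwa [show z + s • a - s • A (θ - θs) - z = s • (a - A (θ - θs)) by rw [smul_sub]; abel] at this
  have h2 : ‖z + s • a‖ ≤ ‖z‖ + s * ‖a‖ := by
    refine (norm_add_le _ _).trans ?_
    rw [norm_smul, Real.norm_of_nonneg hs]
  rw [norm_smul, Real.norm_of_nonneg hs] at h1
  nlinarith [mul_le_mul_of_nonneg_left h hs]

/-- The near-minimisers of `θ ↦ ‖x - s A (θ - θs)‖` over `N₁`. -/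
def linArgmin (A : V →L[ℝ] E) (θs : V) (N₁ : Set V) (s : ℝ) (x : E) (β : ℝ) : Set V :=
  {θ | θ ∈ N₁ ∧ ∀ θ' ∈ N₁, ‖x - s • A (θ - θs)‖ ≤ ‖x - s • A (θ' - θs)‖ + β}

variable {A : V →L[ℝ] E} {θs : V} {N₁ : Set V} {a z : E} {s κ R ρ β : ℝ}

/-- Comparison with the single point `θs` already confines `θ`: growth of slope `s * κ` must be paid
for by `2 * R` from the perturbation and at most `1` from the tolerance. -/
lemma norm_sub_le_of_le_center (hκ : 0 < κ) (hs : 0 < s)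
    (hA : ∀ θ ∈ N₁, ‖a‖ + κ * ‖θ - θs‖ ≤ ‖a - A (θ - θs)‖) (hz : ‖z‖ ≤ R) (hβ : β ≤ 1)
    {θ : V} (hθ : θ ∈ N₁) (h : ‖z + s • a - s • A (θ - θs)‖ ≤ ‖z + s • a‖ + β) :
    ‖θ - θs‖ ≤ (2 * R + 1) / (κ * s) := by
  have := le_norm_perturbed_sub A θs a z hs.le (hA θ hθ)
  rw [le_div_iff₀ (by positivity)]
  linarith [mul_comm ‖θ - θs‖ (κ * s), mul_comm κ s]

lemma linArgmin_subset_closedBall (hκ : 0 < κ) (hs : 0 < s)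
    (hA : ∀ θ ∈ N₁, ‖a‖ + κ * ‖θ - θs‖ ≤ ‖a - A (θ - θs)‖) (hθs : θs ∈ N₁)
    (hz : ‖z‖ ≤ R) (hβ : β ≤ 1) :
    linArgmin A θs N₁ s (z + s • a) β ⊆ Metric.closedBall θs ((2 * R + 1) / (κ * s)) := by
  rintro θ ⟨hθ, h⟩
  rw [mem_closedBall_iff_norm]
  exact norm_sub_le_of_le_center hκ hs hA hz hβ hθ (by simpa using h θs hθs)

lemma convexOn_norm_sub_smul (A : V →L[ℝ] E) (θs : V) (s : ℝ) (x : E) :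
    ConvexOn ℝ Set.univ fun θ => ‖x - s • A (θ - θs)‖ := by
  refine ⟨convex_univ, fun θ _ θ' _ p q hp hq hpq => ?_⟩
  have : x - s • A (p • θ + q • θ' - θs)
      = p • (x - s • A (θ - θs)) + q • (x - s • A (θ' - θs)) := by
    obtain rfl : q = 1 - p := by linarith
    simp only [map_sub, map_add, map_smul]
    module
  simp only [this, smul_eq_mul]
  refine (norm_add_le _ _).trans ?_
  rw [norm_smul, norm_smul, Real.norm_of_nonneg hp, Real.norm_of_nonneg hq]

/-- `N₁` need be neither closed nor convex. Once the confining ball fits inside it, the ball can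
take its place as the constraint, and what remains is an intersection of closed convex sublevel
sets. -/
lemma linArgmin_eq_inter (hκ : 0 < κ) (hs : 0 < s)
    (hA : ∀ θ ∈ N₁, ‖a‖ + κ * ‖θ - θs‖ ≤ ‖a - A (θ - θs)‖) (hθs : θs ∈ N₁)
    (hz : ‖z‖ ≤ R) (hβ : β ≤ 1)
    (hsub : Metric.closedBall θs ((2 * R + 1) / (κ * s)) ⊆ N₁) :
    linArgmin A θs N₁ s (z + s • a) β =
      Metric.closedBall θs ((2 * R + 1) / (κ * s)) ∩ ⋂ θ' ∈ N₁,
        {θ | ‖z + s • a - s • A (θ - θs)‖ ≤ ‖z + s • a - s • A (θ' - θs)‖ + β} := by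
  ext θ
  simp only [Set.mem_inter_iff, Set.mem_iInter, Set.mem_ofPred_eq]
  exact ⟨fun h => ⟨linArgmin_subset_closedBall hκ hs hA hθs hz hβ h, h.2⟩,
    fun h => ⟨hsub h.1, h.2⟩⟩

lemma isCompact_linArgmin [FiniteDimensional ℝ V] (hκ : 0 < κ) (hs : 0 < s)
    (hA : ∀ θ ∈ N₁, ‖a‖ + κ * ‖θ - θs‖ ≤ ‖a - A (θ - θs)‖) (hθs : θs ∈ N₁)
    (hz : ‖z‖ ≤ R) (hβ : β ≤ 1)
    (hsub : Metric.closedBall θs ((2 * R + 1) / (κ * s)) ⊆ N₁) :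
    IsCompact (linArgmin A θs N₁ s (z + s • a) β) := by
  have := FiniteDimensional.proper ℝ V
  rw [linArgmin_eq_inter hκ hs hA hθs hz hβ hsub]
  refine (isCompact_closedBall _ _).inter_right (isClosed_biInter fun θ' _ => ?_)
  exact isClosed_le (by fun_prop) continuous_const

lemma convex_linArgmin (hκ : 0 < κ) (hs : 0 < s)
    (hA : ∀ θ ∈ N₁, ‖a‖ + κ * ‖θ - θs‖ ≤ ‖a - A (θ - θs)‖) (hθs : θs ∈ N₁)
    (hz : ‖z‖ ≤ R) (hβ : β ≤ 1)
    (hsub : Metric.closedBall θs ((2 * R + 1) / (κ * s)) ⊆ N₁) :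
    Convex ℝ (linArgmin A θs N₁ s (z + s • a) β) := by
  rw [linArgmin_eq_inter hκ hs hA hθs hz hβ hsub]
  refine (convex_closedBall _ _).inter (convex_iInter₂ fun θ' _ => ?_)
  simpa using (convexOn_norm_sub_smul A θs s (z + s • a)).convex_le
    (‖z + s • a - s • A (θ' - θs)‖ + β)

/-- A minimiser over the compact ball is a minimiser over `N₁`, because points of `N₁` outside the
ball do worse than the centre. -/
lemma linArgmin_nonempty [FiniteDimensional ℝ V] (hκ : 0 < κ) (hs : 0 < s)
    (hA : ∀ θ ∈ N₁, ‖a‖ + κ * ‖θ - θs‖ ≤ ‖a - A (θ - θs)‖)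
    (hz : ‖z‖ ≤ R) (hβ0 : 0 ≤ β)
    (hsub : Metric.closedBall θs ((2 * R + 1) / (κ * s)) ⊆ N₁) :
    (linArgmin A θs N₁ s (z + s • a) β).Nonempty := by
  have := FiniteDimensional.proper ℝ V
  have hR : 0 ≤ R := (norm_nonneg z).trans hz
  have hc : θs ∈ Metric.closedBall θs ((2 * R + 1) / (κ * s)) :=
    Metric.mem_closedBall_self (by positivity)
  obtain ⟨θ, hθ, hmin⟩ := (isCompact_closedBall θs ((2 * R + 1) / (κ * s))).exists_isMinOn
    ⟨θs, hc⟩ (f := fun θ => ‖z + s • a - s • A (θ - θs)‖) (by fun_prop)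
  refine ⟨θ, hsub hθ, fun θ' hθ' => ?_⟩
  by_cases h : θ' ∈ Metric.closedBall θs ((2 * R + 1) / (κ * s))
  · exact (isMinOn_iff.mp hmin θ' h).trans (le_add_of_nonneg_right hβ0)
  · have h1 : ‖z + s • a‖ < ‖z + s • a - s • A (θ' - θs)‖ := by
      by_contra! h2
      exact h (mem_closedBall_iff_norm.mpr
        (norm_sub_le_of_le_center hκ hs hA hz zero_le_one hθ' (by linarith)))
    have h3 : ‖z + s • a - s • A (θ - θs)‖ ≤ ‖z + s • a‖ := by simpa using hmin hc
    linarith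

/-- Approximate minimisers of the distance to `φ θ` are near-minimisers of the linearised
criterion. -/
lemma mem_linArgmin_of_near_min {φ : V → E} {c η ε : ℝ} (hc : 0 < c) (hs : 0 < s)
    (hφ : φ θs = 0) (hA : ∀ θ ∈ N₁, ‖a‖ + c / 2 * ‖θ - θs‖ ≤ ‖a - A (θ - θs)‖)
    (hθs : θs ∈ N₁) (hz : ‖z‖ ≤ R) (hη : η ≤ 1) (hε : 0 ≤ ε)
    (hsub : Metric.closedBall θs ((2 * R + 1) / (c / 2 * s)) ⊆ N₁)
    (hlin : ∀ θ ∈ Metric.closedBall θs ((2 * R + 1) / (c / 2 * s)),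
      ‖φ θ - A (θ - θs)‖ ≤ ε * ‖θ - θs‖)
    (hβ : η + 2 * ε * ((2 * R + 1) / (c / 2)) ≤ β) {θ : V}
    (hid : ‖a‖ + c * ‖θ - θs‖ ≤ ‖φ θ - a‖)
    (h : ∀ θ' ∈ N₁, ‖z + s • a - s • φ θ‖ ≤ ‖z + s • a - s • φ θ'‖ + η) :
    θ ∈ linArgmin A θs N₁ s (z + s • a) β := by
  have hR : 0 ≤ R := (norm_nonneg z).trans hz
  set r := (2 * R + 1) / (c / 2 * s) with hr
  have hrs : s * r = (2 * R + 1) / (c / 2) := by rw [hr]; field_simp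
  -- The nonlinear criterion has slope `c`, hence a smaller ball than the linearised one of slope `c
  -- / 2`; the larger radius serves both.
  have h1 : ‖θ - θs‖ ≤ r := by
    refine (norm_sub_le_of_near_min hc hs hφ hid hz hη (h θs hθs)).trans ?_
    rw [hr]
    gcongr
    linarith
  have hmem : θ ∈ Metric.closedBall θs r := mem_closedBall_iff_norm.mpr h1
  have hdiff : ∀ θ' ∈ Metric.closedBall θs r, ‖s • (φ θ' - A (θ' - θs))‖ ≤ ε * (s * r) := by
    intro θ' hθ'
    rw [norm_smul, Real.norm_of_nonneg hs.le]
    have h2 := hlin θ' hθ'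
    have h3 := mem_closedBall_iff_norm.mp hθ'
    calc s * ‖φ θ' - A (θ' - θs)‖ ≤ s * (ε * r) := by
          gcongr
          exact h2.trans (by gcongr)
      _ = ε * (s * r) := by ring
  have hup : ‖z + s • a - s • A (θ - θs)‖ ≤ ‖z + s • a - s • φ θ‖ + ε * (s * r) := by
    refine le_trans ?_ (add_le_add_right (hdiff θ hmem) _)
    refine le_trans (le_of_eq ?_) (norm_add_le _ _)
    congr 1
    rw [smul_sub]; abel
  refine ⟨hsub hmem, fun θ' hθ' => ?_⟩
  have hεr : 0 ≤ ε * (s * r) := by rw [hrs]; positivity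
  rw [← hrs] at hβ
  -- Inside the ball the linearisation error is paid twice, at `θ` and at `θ'`. Outside, `θ'` is
  -- already worse than `θs`, where both criteria agree, so `θs` serves as the competitor.
  by_cases hb : θ' ∈ Metric.closedBall θs r
  · have h4 : ‖z + s • a - s • φ θ'‖ ≤ ‖z + s • a - s • A (θ' - θs)‖ + ε * (s * r) := by
      refine le_trans ?_ (add_le_add_right (hdiff θ' hb) _)
      refine le_trans (le_of_eq ?_) (norm_sub_le _ _)
      congr 1
      rw [smul_sub]; abel
    linarith [h θ' hθ']
  · have h5 : ‖z + s • a‖ < ‖z + s • a - s • A (θ' - θs)‖ := by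
      by_contra! h2
      exact hb (mem_closedBall_iff_norm.mpr
        (norm_sub_le_of_le_center (half_pos hc) hs hA hz zero_le_one hθ' (by linarith)))
    have h6 := h θs hθs
    rw [hφ, smul_zero, sub_zero] at h6
    linarith

end Deterministic

/-! ### The one-dimensional Wasserstein distance via distribution functions -/

section Wasserstein

lemma lintegral_step_sub_eq (a b : ℝ) :
    ∫⁻ t, ‖(if a ≤ t then (1 : ℝ) else 0) - (if b ≤ t then 1 else 0)‖ₑ = edist a b := by
  calc ∫⁻ t, ‖(if a ≤ t then (1 : ℝ) else 0) - (if b ≤ t then 1 else 0)‖ₑ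
      = ∫⁻ t, (Set.Ico (min a b) (max a b)).indicator 1 t := by
        refine lintegral_congr fun t => ?_
        by_cases h1 : a ≤ t <;> by_cases h2 : b ≤ t <;>
          simp [h1, h2, Set.indicator, not_le.mp]
    _ = volume (Set.Ico (min a b) (max a b)) := lintegral_indicator_one measurableSet_Ico
    _ = edist a b := by
        rw [Real.volume_Ico, max_sub_min_eq_abs', edist_dist, Real.dist_eq]

/-- Here the integration variable plays the role of the level `p`, and `a`, `b` are values of
distribution functions. -/
lemma lintegral_ge_step_sub (a b : ℝ) :
    ∫⁻ t, ‖(if t ≤ a then (1 : ℝ) else 0) - (if t ≤ b then 1 else 0)‖ₑ = ‖a - b‖ₑ := by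
  calc ∫⁻ t, ‖(if t ≤ a then (1 : ℝ) else 0) - (if t ≤ b then 1 else 0)‖ₑ
      = ∫⁻ t, (Set.Ioc (min a b) (max a b)).indicator 1 t := by
        refine lintegral_congr fun t => ?_
        by_cases h1 : t ≤ a <;> by_cases h2 : t ≤ b <;>
          simp [h1, h2, Set.indicator, not_le.mp]
    _ = volume (Set.Ioc (min a b) (max a b)) := lintegral_indicator_one measurableSet_Ioc
    _ = ‖a - b‖ₑ := by
        rw [Real.volume_Ioc, max_sub_min_eq_abs', Real.enorm_eq_ofReal_abs]

/-- Tonelli applied to the layer-cake formula for `|X - Y|`. It turns the transport cost of a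
coupling into an integral over thresholds `t`. -/
lemma lintegral_lintegral_step_sub {α : Type*} [MeasurableSpace α] (π : Measure α) [SFinite π]
    {X Y : α → ℝ} (hX : AEMeasurable X π) (hY : AEMeasurable Y π) :
    ∫⁻ t : ℝ, ∫⁻ z, ‖(if X z ≤ t then (1 : ℝ) else 0) - (if Y z ≤ t then 1 else 0)‖ₑ ∂π
      = ∫⁻ z, edist (X z) (Y z) ∂π := by
  have hm : AEMeasurable (Function.uncurry fun (t : ℝ) (z : α) =>
      ‖(if X z ≤ t then (1 : ℝ) else 0) - (if Y z ≤ t then 1 else 0)‖ₑ) (volume.prod π) := by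
    have hf : Measurable fun q : ℝ × ℝ × ℝ =>
        ‖(if q.2.1 ≤ q.1 then (1 : ℝ) else 0) - (if q.2.2 ≤ q.1 then 1 else 0)‖ₑ := by
      refine Measurable.enorm (Measurable.sub ?_ ?_)
      · exact Measurable.ite (measurableSet_le (by fun_prop) (by fun_prop))
          measurable_const measurable_const
      · exact Measurable.ite (measurableSet_le (by fun_prop) (by fun_prop))
          measurable_const measurable_const
    exact hf.comp_aemeasurable (f := fun p : ℝ × α => (p.1, X p.2, Y p.2))
      (measurable_fst.aemeasurable.prodMk (hX.comp_snd.prodMk hY.comp_snd))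
  rw [lintegral_lintegral_swap hm]
  exact lintegral_congr fun z => lintegral_step_sub_eq _ _

lemma enorm_measureReal_sub_le {α : Type*} [MeasurableSpace α] (π : Measure α)
    [IsFiniteMeasure π] {X Y : α → ℝ} (hX : Measurable X) (hY : Measurable Y) (t : ℝ) :
    ‖π.real {z | X z ≤ t} - π.real {z | Y z ≤ t}‖ₑ
      ≤ ∫⁻ z, ‖(if X z ≤ t then (1 : ℝ) else 0) - (if Y z ≤ t then 1 else 0)‖ₑ ∂π := by
  have key {Z : α → ℝ} (hZ : Measurable Z) :
      Integrable (fun z => if Z z ≤ t then (1 : ℝ) else 0) π ∧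
      ∫ z, (if Z z ≤ t then (1 : ℝ) else 0) ∂π = π.real {z | Z z ≤ t} := by
    have hm : MeasurableSet {z | Z z ≤ t} := measurableSet_le hZ measurable_const
    have hi : (fun z => if Z z ≤ t then (1 : ℝ) else 0) = {z | Z z ≤ t}.indicator 1 := by
      ext z; simp [Set.indicator]
    rw [hi]
    exact ⟨(integrable_const (1 : ℝ)).indicator hm, integral_indicator_one hm⟩
  rw [← (key hX).2, ← (key hY).2, ← integral_sub (key hX).1 (key hY).1]
  exact enorm_integral_le_lintegral_enorm _

/-- The quantile function of a probability measure on `ℝ`. -/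
noncomputable def quantile (μ : Measure ℝ) (p : ℝ) : ℝ := sInf {t | p ≤ μ.real (Set.Iic t)}

variable (μ ν : Measure ℝ) [IsProbabilityMeasure μ] [IsProbabilityMeasure ν]

/-- Right continuity of the distribution function means that the infimum defining the quantile is
attained. For `p` outside `(0, 1)` the set may be empty or unbounded below. -/
lemma quantile_le_iff {p : ℝ} (hp : p ∈ Set.Ioo (0 : ℝ) 1) (t : ℝ) :
    quantile μ p ≤ t ↔ p ≤ μ.real (Set.Iic t) := by
  have hmono : Monotone fun t => μ.real (Set.Iic t) := fun a b h =>
    measureReal_mono (Set.Iic_subset_Iic.mpr h)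
  have hne : {t | p ≤ μ.real (Set.Iic t)}.Nonempty := by
    have h := ProbabilityTheory.tendsto_cdf_atTop μ
    obtain ⟨t, ht⟩ := (h.eventually (lt_mem_nhds hp.2)).exists
    exact ⟨t, by rw [ProbabilityTheory.cdf_eq_real] at ht; exact ht.le⟩
  have hbdd : BddBelow {t | p ≤ μ.real (Set.Iic t)} := by
    have h := ProbabilityTheory.tendsto_cdf_atBot μ
    obtain ⟨s, hs⟩ := (h.eventually (gt_mem_nhds hp.1)).exists
    rw [ProbabilityTheory.cdf_eq_real] at hs
    refine ⟨s, fun t ht => ?_⟩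
    by_contra! hlt
    exact absurd (hmono hlt.le) (not_le.mpr (hs.trans_le ht))
  refine ⟨fun h => ?_, fun h => csInf_le hbdd h⟩
  have hq : p ≤ μ.real (Set.Iic (quantile μ p)) := by
    have hc := (ProbabilityTheory.cdf μ).right_continuous (quantile μ p)
    rw [← continuousWithinAt_Ioi_iff_Ici] at hc
    rw [← ProbabilityTheory.cdf_eq_real]
    refine ge_of_tendsto hc ?_
    filter_upwards [self_mem_nhdsWithin] with s hs
    obtain ⟨t, ht, hts⟩ := exists_lt_of_csInf_lt hne (Set.mem_Ioi.mp hs)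
    rw [ProbabilityTheory.cdf_eq_real]
    exact le_trans ht (hmono hts.le)
  exact hq.trans (hmono h)

lemma aemeasurable_quantile :
    AEMeasurable (quantile μ) (volume.restrict (Set.Ioo 0 1)) := by
  refine aemeasurable_restrict_of_monotoneOn measurableSet_Ioo fun p hp q hq hpq => ?_
  rw [quantile_le_iff μ hp]
  exact hpq.trans ((quantile_le_iff μ hq _).mp le_rfl)

lemma map_quantile : (volume.restrict (Set.Ioo 0 1)).map (quantile μ) = μ := by
  have : IsFiniteMeasure ((volume.restrict (Set.Ioo (0 : ℝ) 1)).map (quantile μ)) :=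
    Measure.isFiniteMeasure_map _ _
  refine Measure.ext_of_Iic _ _ fun t => ?_
  rw [Measure.map_apply_of_aemeasurable (aemeasurable_quantile μ) measurableSet_Iic,
    Measure.restrict_apply' measurableSet_Ioo]
  have hset : quantile μ ⁻¹' Set.Iic t ∩ Set.Ioo 0 1
      = Set.Ioo 0 1 ∩ Set.Iic (μ.real (Set.Iic t)) := by
    ext p
    simp only [Set.mem_inter_iff, Set.mem_preimage, Set.mem_Iic]
    rw [and_comm]
    exact and_congr_right fun hp => quantile_le_iff μ hp t
  rw [hset, ← ofReal_measureReal (μ := μ)]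
  -- The right endpoint belongs to the set of levels exactly when it is below `1`, so the set is
  -- `Ioc` or `Ioo`.
  rcases lt_or_eq_of_le (measureReal_le_one (μ := μ) (s := Set.Iic t)) with h | h
  · have : Set.Ioo 0 1 ∩ Set.Iic (μ.real (Set.Iic t)) = Set.Ioc 0 (μ.real (Set.Iic t)) := by
      ext p; simp only [Set.mem_inter_iff, Set.mem_Ioo, Set.mem_Iic, Set.mem_Ioc]; grind
    rw [this, Real.volume_Ioc, sub_zero]
  · have : Set.Ioo 0 1 ∩ Set.Iic (μ.real (Set.Iic t)) = Set.Ioo 0 1 := by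
      ext p; simp only [Set.mem_inter_iff, Set.mem_Ioo, Set.mem_Iic]; grind
    rw [this, Real.volume_Ioo, sub_zero, h]

/-- On the line, the Wasserstein distance of order one is the `L¹` distance of the distribution
functions. -/
theorem wasserstein_eq_lintegral_cdf :
    wasserstein μ ν = ∫⁻ t, ‖μ.real (Set.Iic t) - ν.real (Set.Iic t)‖ₑ := by
  apply le_antisymm
  · have hpair := (aemeasurable_quantile μ).prodMk (aemeasurable_quantile ν)
    -- The optimal coupling is the monotone one. For each `t` the two quantile indicators are
    -- indicators of `p ≤ F t` and `p ≤ G t`, so integrating their difference over `p` gives at most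
    -- `|F t - G t|`.
    refine (iInf₂_le ((volume.restrict (Set.Ioo (0 : ℝ) 1)).map fun p =>
      (quantile μ p, quantile ν p)) ⟨?_, ?_⟩).trans ?_
    · rw [lintegral_map' (by fun_prop) hpair,
        ← lintegral_lintegral_step_sub _ (aemeasurable_quantile μ) (aemeasurable_quantile ν)]
      refine lintegral_mono fun t => ?_
      rw [← lintegral_ge_step_sub]
      refine le_trans (le_of_eq ?_) (setLIntegral_le_lintegral (Set.Ioo (0 : ℝ) 1) _)
      refine setLIntegral_congr_fun measurableSet_Ioo fun p hp => ?_
      simp only [quantile_le_iff μ hp, quantile_le_iff ν hp]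
    · rw [AEMeasurable.map_map_of_aemeasurable measurable_fst.aemeasurable hpair]
      exact map_quantile μ
    · rw [AEMeasurable.map_map_of_aemeasurable measurable_snd.aemeasurable hpair]
      exact map_quantile ν
  -- For any coupling, `|F t - G t|` is at most the expected difference of the indicators;
  -- integrating over `t` gives the transport cost.
  · refine le_iInf₂ fun π hπ => ?_
    have : IsProbabilityMeasure (π.map Prod.fst) := hπ.1 ▸ inferInstance
    have : IsProbabilityMeasure π := Measure.isProbabilityMeasure_of_map Prod.fst
    rw [← lintegral_lintegral_step_sub π measurable_fst.aemeasurable measurable_snd.aemeasurable]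
    refine lintegral_mono fun t => ?_
    refine le_trans (le_of_eq ?_) (enorm_measureReal_sub_le π measurable_fst measurable_snd t)
    rw [← hπ.1, ← hπ.2, map_measureReal_apply measurable_fst measurableSet_Iic,
      map_measureReal_apply measurable_snd measurableSet_Iic]
    rfl

end Wasserstein

variable {d : ℕ}

/-- The max-sliced Wasserstein distance is the `L`-distance of the projected distribution
functions. -/
theorem maxSW_eq_normL (μ ν : Measure (Space d)) [IsProbabilityMeasure μ]
    [IsProbabilityMeasure ν] : maxSW μ ν = normL (projCDF μ - projCDF ν) := by
  refine iSup_congr fun u => ?_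
  have hm : Measurable fun x : Space d => (inner ℝ (u : Space d) x : ℝ) := by fun_prop
  have := Measure.isProbabilityMeasure_map (μ := μ) hm.aemeasurable
  have := Measure.isProbabilityMeasure_map (μ := ν) hm.aemeasurable
  rw [wasserstein_eq_lintegral_cdf]
  refine lintegral_congr fun t => ?_
  rw [map_measureReal_apply hm measurableSet_Iic, map_measureReal_apply hm measurableSet_Iic]
  rfl

lemma isProbabilityMeasure_empMeasure (x : ℕ → Space d) {n : ℕ} (hn : n ≠ 0) :
    IsProbabilityMeasure (empMeasure x n) := by
  constructor
  simp only [empMeasure, Measure.smul_apply, Measure.finsetSum_apply, measure_univ,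
    Finset.sum_const, Finset.card_range, nsmul_eq_mul, mul_one, smul_eq_mul]
  exact ENNReal.inv_mul_cancel (by exact_mod_cast hn) (ENNReal.natCast_ne_top n)

lemma projCDF_empMeasure (x : ℕ → Space d) (n : ℕ) :
    projCDF (empMeasure x n) = empCDF x n := by
  classical
  ext u t
  have hm : MeasurableSet {y : Space d | inner ℝ (u : Space d) y ≤ t} :=
    measurableSet_le (by fun_prop) measurable_const
  simp only [projCDF, empCDF, empMeasure, measureReal_def, Measure.smul_apply,
    Measure.finsetSum_apply, Measure.dirac_apply' _ hm, smul_eq_mul, ENNReal.toReal_mul,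
    ENNReal.toReal_inv, ENNReal.toReal_natCast, Set.indicator, Pi.one_apply, one_div]
  congr 1
  rw [Finset.sum_boole, ENNReal.toReal_natCast]
  congr!

noncomputable section

variable {d : ℕ}

/-! ### The seminormed space `L` -/

section NormL

lemma normL_add_le {f : USphere d → ℝ → ℝ} (hf : ∀ u, AEStronglyMeasurable (f u) volume)
    (g : USphere d → ℝ → ℝ) : normL (f + g) ≤ normL f + normL g := by
  refine iSup_le fun u => ?_
  calc ∫⁻ t, ‖(f + g) u t‖ₑ ≤ ∫⁻ t, (‖f u t‖ₑ + ‖g u t‖ₑ) :=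
        lintegral_mono fun t => enorm_add_le _ _
    _ = (∫⁻ t, ‖f u t‖ₑ) + ∫⁻ t, ‖g u t‖ₑ := lintegral_add_left' (hf u).enorm _
    _ ≤ _ := add_le_add (le_iSup (fun u => ∫⁻ t, ‖f u t‖ₑ) u)
        (le_iSup (fun u => ∫⁻ t, ‖g u t‖ₑ) u)

lemma normL_smul (c : ℝ) (f : USphere d → ℝ → ℝ) : normL (c • f) = ‖c‖ₑ * normL f := by
  rw [normL, normL, ENNReal.mul_iSup]
  refine iSup_congr fun u => ?_
  rw [← lintegral_const_mul' _ _ enorm_ne_top]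
  exact lintegral_congr fun t => by simp [enorm_mul]

/-- The space `L` as a subspace of the space of all functions on `S^{d-1} × ℝ`. -/
def lSubmodule (d : ℕ) : Submodule ℝ (USphere d → ℝ → ℝ) where
  carrier := {f | (∀ u, Integrable (f u) volume) ∧ normL f < ∞}
  zero_mem' := by
    refine ⟨fun u => integrable_zero _ _ _, ?_⟩
    simp [normL]
  add_mem' {f g} hf hg := ⟨fun u => (hf.1 u).add (hg.1 u),
    (normL_add_le (fun u => (hf.1 u).aestronglyMeasurable) g).trans_lt
      (ENNReal.add_lt_top.mpr ⟨hf.2, hg.2⟩)⟩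
  smul_mem' c f hf := ⟨fun u => (hf.1 u).smul c, by
    rw [normL_smul]
    exact ENNReal.mul_lt_top enorm_lt_top hf.2⟩

/-- The space `L`, as a type that carries the seminorm `‖·‖_L`. -/
def LMod (d : ℕ) : Type := lSubmodule d

instance : AddCommGroup (LMod d) := inferInstanceAs (AddCommGroup (lSubmodule d))

instance : Module ℝ (LMod d) := inferInstanceAs (Module ℝ (lSubmodule d))

instance : Norm (LMod d) := ⟨fun f => (normL f.1).toReal⟩

lemma LMod.norm_def (f : LMod d) : ‖f‖ = (normL f.1).toReal := rfl

lemma LMod.seminormedSpaceCore : SeminormedSpace.Core ℝ (LMod d) where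
  norm_nonneg _ := ENNReal.toReal_nonneg
  norm_smul c f := by
    rw [LMod.norm_def, LMod.norm_def, show (c • f).1 = c • f.1 from rfl, normL_smul,
      ENNReal.toReal_mul, toReal_enorm]
  norm_triangle f g := by
    rw [LMod.norm_def, LMod.norm_def, LMod.norm_def,
      ← ENNReal.toReal_add f.2.2.ne g.2.2.ne]
    exact ENNReal.toReal_mono (ENNReal.add_ne_top.mpr ⟨f.2.2.ne, g.2.2.ne⟩)
      (normL_add_le (fun u => (f.2.1 u).aestronglyMeasurable) g.1)

instance : SeminormedAddCommGroup (LMod d) :=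
  SeminormedAddCommGroup.ofCore LMod.seminormedSpaceCore

instance : NormedSpace ℝ (LMod d) where
  norm_smul_le c f := (LMod.seminormedSpaceCore.norm_smul c f).le

lemma LMod.normL_eq (f : LMod d) : normL f.1 = ENNReal.ofReal ‖f‖ :=
  (ENNReal.ofReal_toReal f.2.2.ne).symm

end NormL

/-! ### Projected distribution functions and the population criterion -/

section Model

/-- Both functions are compared with the distribution function of the point mass at the origin,
whose `L`-distance to each is at most the first moment. -/
lemma projCDF_sub_mem (μ ν : Measure (Space d)) [IsProbabilityMeasure μ] [IsProbabilityMeasure ν]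
    (hμ : Integrable (fun y => ‖y‖) μ) (hν : Integrable (fun y => ‖y‖) ν) :
    projCDF μ - projCDF ν ∈ lSubmodule d := by
  have key (ρ : Measure (Space d)) [IsProbabilityMeasure ρ] (hρ : Integrable (fun y => ‖y‖) ρ) :
      (fun (_ : USphere d) t => if (0 : ℝ) ≤ t then (1 : ℝ) else 0) - projCDF ρ
        ∈ lSubmodule d := by
    have hfin : ∫⁻ y, ‖y‖ₑ ∂ρ < ∞ := by simpa [HasFiniteIntegral] using hρ.hasFiniteIntegral
    have hb (u : USphere d) :
        ∫⁻ t, ‖(if (0 : ℝ) ≤ t then (1 : ℝ) else 0) - projCDF ρ u t‖ₑ ≤ ∫⁻ y, ‖y‖ₑ ∂ρ := by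
      simpa using lintegral_step_sub_projCDF ρ u 0
    have hm (u : USphere d) :
        Measurable fun t : ℝ => (if (0 : ℝ) ≤ t then (1 : ℝ) else 0) - projCDF ρ u t :=
      (Measurable.ite measurableSet_Ici measurable_const measurable_const).sub
        (measurable_projCDF ρ u)
    exact ⟨fun u => ⟨(hm u).aestronglyMeasurable, (hb u).trans_lt hfin⟩,
      (iSup_le hb).trans_lt hfin⟩
  simpa using (lSubmodule d).sub_mem (key ν hν) (key μ hμ)

lemma maxSW_comm (μ ν : Measure (Space d)) [IsProbabilityMeasure μ] [IsProbabilityMeasure ν] :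
    maxSW μ ν = maxSW ν μ := by
  rw [maxSW_eq_normL, maxSW_eq_normL]
  simp only [normL, Pi.sub_apply]
  exact iSup_congr fun u => lintegral_congr fun t => by rw [← enorm_neg, neg_sub]

variable {V : Type*} [NormedAddCommGroup V]

/-- Convergence can fail only when the hyperplane `⟪u, x⟫ = t` has positive limit mass, which
happens for countably many `t`. -/
lemma tendsto_projCDF {ι : Type*} {l : Filter ι} {μs : ι → ProbabilityMeasure (Space d)}
    {μ : ProbabilityMeasure (Space d)} (h : Tendsto μs l (𝓝 μ)) (u : USphere d) :
    ∀ᵐ t : ℝ, Tendsto (fun i => projCDF (μs i : Measure (Space d)) u t) l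
      (𝓝 (projCDF (μ : Measure (Space d)) u t)) := by
  have hm : Measurable fun x : Space d => (inner ℝ (u : Space d) x : ℝ) := by fun_prop
  have hc := Measure.countable_meas_level_set_pos (μ := (μ : Measure (Space d))) hm
  filter_upwards [hc.ae_notMem volume] with t ht
  have h0 : (μ : Measure (Space d)) (frontier {x | inner ℝ (u : Space d) x ≤ t}) = 0 := by
    refine measure_mono_null (frontier_le_subset_eq (by fun_prop) continuous_const) ?_
    simpa using ht
  have := ProbabilityMeasure.tendsto_measure_of_null_frontier_of_tendsto' h h0
  exact (ENNReal.tendsto_toReal (measure_ne_top _ _)).comp this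

/-- Fatou's lemma gives lower semicontinuity for each direction `u`, and suprema preserve it. Weak
continuity of the model does not control first moments, so full continuity is not available. -/
lemma lowerSemicontinuousOn_maxSW {Θ : Set V} {μ : V → ProbabilityMeasure (Space d)}
    (hμ : ContinuousOn μ Θ) (μs : ProbabilityMeasure (Space d)) :
    LowerSemicontinuousOn (fun θ => maxSW (μs : Measure (Space d)) (μ θ)) Θ := by
  simp only [maxSW_eq_normL, normL]
  refine lowerSemicontinuousOn_iSup fun u θ hθ y hy => ?_
  refine eventually_lt_of_lt_liminf (hy.trans_le ?_)
  have : (𝓝[Θ] θ).NeBot := mem_closure_iff_nhdsWithin_neBot.mp (subset_closure hθ)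
  refine le_trans (le_of_eq ?_) (lintegral_liminf_le fun θ' =>
    ((measurable_projCDF _ u).sub (measurable_projCDF _ u)).enorm)
  refine lintegral_congr_ae ?_
  filter_upwards [tendsto_projCDF (hμ θ hθ) u] with t ht
  exact ((continuous_enorm.tendsto _).comp (ht.const_sub _)).liminf_eq.symm

/-- Approximate minimisers of the population criterion are close to the unique minimiser. -/
lemma exists_maxSW_le_imp_mem [NormedSpace ℝ V] [FiniteDimensional ℝ V] {Θ N : Set V} {θs : V}
    {μ : V → ProbabilityMeasure (Space d)} (hμ : ContinuousOn μ Θ)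
    {μs : ProbabilityMeasure (Space d)} (hθs : θs ∈ Θ)
    (hfin : maxSW (μs : Measure (Space d)) (μ θs) ≠ ∞)
    (hτ : ∃ τ : ℝ, 0 < τ ∧ Bornology.IsBounded (popNearArgmin Θ μ μs τ) ∧
      closure (popNearArgmin Θ μ μs τ) ⊆ Θ)
    (hmin : ∀ θ ∈ Θ, θ ≠ θs →
      maxSW (μs : Measure (Space d)) (μ θs) < maxSW (μs : Measure (Space d)) (μ θ))
    (hN : N ∈ 𝓝 θs) :
    ∃ γ : ℝ, 0 < γ ∧ ∀ θ ∈ Θ, maxSW (μs : Measure (Space d)) (μ θ)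
      ≤ maxSW (μs : Measure (Space d)) (μ θs) + ENNReal.ofReal γ → θ ∈ N := by
  obtain ⟨τ, hτ0, hbdd, hcl⟩ := hτ
  have := FiniteDimensional.proper ℝ V
  set S := closure (popNearArgmin Θ μ μs τ) \ interior N with hS
  -- The criterion attains its minimum on this compact set of near-minimisers away from `θs`; by
  -- uniqueness that minimum is strictly above the value at `θs`, and `γ` fits in the gap.
  have hScompact : IsCompact S := hbdd.isCompact_closure.diff isOpen_interior
  have hSΘ : S ⊆ Θ := Set.sdiff_subset.trans hcl
  have hinf : maxSW (μs : Measure (Space d)) (μ θs)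
      ≤ ⨅ θ' ∈ Θ, maxSW (μs : Measure (Space d)) (μ θ') := by
    refine le_iInf₂ fun θ hθ => ?_
    rcases eq_or_ne θ θs with rfl | h
    exacts [le_rfl, (hmin θ hθ h).le]
  have hmemS {γ : ℝ} (hγ : γ ≤ τ) {θ : V} (hθ : θ ∈ Θ)
      (h : maxSW (μs : Measure (Space d)) (μ θ)
        ≤ maxSW (μs : Measure (Space d)) (μ θs) + ENNReal.ofReal γ) (hθN : θ ∉ N) : θ ∈ S :=
    ⟨subset_closure ⟨hθ, h.trans (add_le_add hinf (ENNReal.ofReal_le_ofReal hγ))⟩,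
      fun hi => hθN (interior_subset hi)⟩
  rcases S.eq_empty_or_nonempty with hem | hne
  · refine ⟨τ, hτ0, fun θ hθ h => ?_⟩
    by_contra hθN
    exact Set.notMem_empty θ (hem ▸ hmemS le_rfl hθ h hθN)
  obtain ⟨θ₁, hθ₁, hθ₁min⟩ := LowerSemicontinuousOn.exists_isMinOn hne hScompact
    ((lowerSemicontinuousOn_maxSW hμ μs).mono hSΘ)
  have hne₁ : θ₁ ≠ θs := by
    rintro rfl
    exact hθ₁.2 (mem_interior_iff_mem_nhds.mpr hN)
  obtain ⟨r, hr0, hr⟩ := ENNReal.lt_iff_exists_add_pos_lt.mp (hmin θ₁ (hSΘ hθ₁) hne₁)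
  refine ⟨min τ r, lt_min hτ0 (by exact_mod_cast hr0), fun θ hθ h => ?_⟩
  by_contra hθN
  have h1 := isMinOn_iff.mp hθ₁min θ (hmemS (min_le_left _ _) hθ h hθN)
  refine absurd (h1.trans h) (not_le.mpr (lt_of_le_of_lt ?_ hr))
  gcongr
  exact (ENNReal.ofReal_le_ofReal (min_le_right _ _)).trans_eq ENNReal.ofReal_coe_nnreal

/-- The functions `⟨v, D⟩` belong to `L`. -/
lemma derivative_apply_mem [NormedSpace ℝ V] {Θ : Set V} {θs : V} (hθs : θs ∈ interior Θ)
    {μ : V → ProbabilityMeasure (Space d)}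
    (hμ : ∀ θ ∈ Θ, Integrable (fun y => ‖y‖) (μ θ : Measure (Space d)))
    {D : USphere d → ℝ → StrongDual ℝ V} (hD : Measurable (Function.uncurry D))
    (hrem : ∀ᶠ θ in 𝓝[Θ] θs, normL (remainder μ θs D θ) < ∞) (v : V) :
    (fun u t => D u t v) ∈ lSubmodule d := by
  have hmeas (u : USphere d) (w : V) : Measurable fun t => D u t w :=
    (ContinuousLinearMap.measurable_apply w).comp (hD.comp measurable_prodMk_left)
  have hΘ : Θ ∈ 𝓝 θs := mem_interior_iff_mem_nhds.mp hθs
  rw [nhdsWithin_eq_nhds.mpr hΘ] at hrem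
  have hlim : Tendsto (fun r : ℝ => θs + r • v) (𝓝[>] 0) (𝓝 θs) := by
    have : Tendsto (fun r : ℝ => θs + r • v) (𝓝 0) (𝓝 (θs + (0 : ℝ) • v)) :=
      Continuous.tendsto (by fun_prop) 0
    simpa using this.mono_left nhdsWithin_le_nhds
  -- For a small step `r` along `v`, `r ⟨v, D⟩` is a difference of distribution functions minus a
  -- remainder of finite norm.
  obtain ⟨r, ⟨hr, hrΘ⟩, hr0⟩ :=
    ((hlim.eventually (hrem.and hΘ)).and self_mem_nhdsWithin).exists
  have hr0 : r ≠ 0 := ne_of_gt hr0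
  have hmem : remainder μ θs D (θs + r • v) ∈ lSubmodule d := by
    refine ⟨fun u => ⟨?_, ?_⟩, hr⟩
    · exact (((measurable_projCDF _ u).sub (measurable_projCDF _ u)).sub
        (hmeas u _)).aestronglyMeasurable
    · exact (le_iSup (fun u => ∫⁻ t, ‖remainder μ θs D (θs + r • v) u t‖ₑ) u).trans_lt hr
  have hsub := (lSubmodule d).smul_mem r⁻¹ ((lSubmodule d).sub_mem
    (projCDF_sub_mem _ _ (hμ _ hrΘ) (hμ _ (interior_subset hθs))) hmem)
  convert hsub using 1
  ext u t
  simp only [Pi.smul_apply, Pi.sub_apply, remainder, add_sub_cancel_left, map_smul, smul_eq_mul,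
    sub_sub_cancel]
  field_simp

end Model

end

/-! ### Uniform asymptotics over bounded perturbations -/

section Deterministic

lemma tendsto_const_div_const_mul_sqrt (C κ : ℝ) :
    Tendsto (fun n : ℕ => C / (κ * √(n : ℝ))) atTop (𝓝 0) := by
  have h : Tendsto (fun n : ℕ => √(n : ℝ)) atTop atTop :=
    Real.tendsto_sqrt_atTop.comp tendsto_natCast_atTop_atTop
  have := (h.const_div_atTop (C / κ))
  simpa [div_div] using this

lemma eventually_closedBall_subset {V : Type*} [NormedAddCommGroup V] {S : Set V} {θs : V} (h : S ∈ 𝓝 θs) (C κ : ℝ) :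
    ∀ᶠ n : ℕ in atTop, Metric.closedBall θs (C / (κ * √(n : ℝ))) ⊆ S := by
  obtain ⟨r, hr, hS⟩ := Metric.nhds_basis_closedBall.mem_iff.mp h
  filter_upwards [(tendsto_const_div_const_mul_sqrt C κ).eventually (gt_mem_nhds hr)] with n hn
  exact (Metric.closedBall_subset_closedBall hn.le).trans hS

/-- The diameter of the ball bounds the distance: any point of one set can be matched with an
arbitrary point of the other. -/
lemma hausdorffEDist_le_of_subset_closedBall {V : Type*} [NormedAddCommGroup V]
    {s t : Set V} {θs : V} {r : ℝ} (hs : s.Nonempty)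
    (ht : t.Nonempty) (hsr : s ⊆ Metric.closedBall θs r) (htr : t ⊆ Metric.closedBall θs r) :
    Metric.hausdorffEDist s t ≤ ENNReal.ofReal (2 * r) := by
  have key {x y : V} (hx : x ∈ Metric.closedBall θs r) (hy : y ∈ Metric.closedBall θs r) :
      edist x y ≤ ENNReal.ofReal (2 * r) := by
    rw [edist_dist]
    refine ENNReal.ofReal_le_ofReal ?_
    linarith [dist_triangle_right x y θs, Metric.mem_closedBall.mp hx, Metric.mem_closedBall.mp hy]
  obtain ⟨x₀, hx₀⟩ := hs
  obtain ⟨y₀, hy₀⟩ := ht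
  exact Metric.hausdorffEDist_le_of_mem_edist (fun x hx => ⟨y₀, hy₀, key (hsr hx) (htr hy₀)⟩)
    fun y hy => ⟨x₀, hx₀, key (htr hy) (hsr hx₀)⟩

variable {V E : Type*} [NormedAddCommGroup V] [NormedSpace ℝ V]
  [SeminormedAddCommGroup E] [NormedSpace ℝ E]

/-- The approximate minimisers over `Θ` of `θ ↦ ‖x - s φ θ‖`. -/
def nearMin (φ : V → E) (Θ : Set V) (s : ℝ) (x : E) (η : ℝ) : Set V :=
  {θ | θ ∈ Θ ∧ ∀ θ' ∈ Θ, ‖x - s • φ θ‖ ≤ ‖x - s • φ θ'‖ + η}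

/-- A model `φ` with derivative `A` at `θs` that separates `θs`, at the linear rate `c` on `N`,
from the other near-minimisers of the distance to `a`. -/
structure IdentifiableLinearization (Θ N N₁ : Set V) (θs : V) (φ : V → E) (A : V →L[ℝ] E)
    (a : E) (c γ : ℝ) : Prop where
  c_pos : 0 < c
  γ_pos : 0 < γ
  center : φ θs = 0
  subset : N₁ ⊆ N
  subset_param : N ⊆ Θ
  mem_nhds : N₁ ∈ 𝓝 θs
  identifiable : ∀ θ ∈ N, ‖a‖ + c * ‖θ - θs‖ ≤ ‖φ θ - a‖
  remainder_le : ∀ θ ∈ N₁, ‖φ θ - A (θ - θs)‖ ≤ c / 2 * ‖θ - θs‖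
  differentiable : ∀ ε : ℝ, 0 < ε → ∀ᶠ θ in 𝓝 θs, ‖φ θ - A (θ - θs)‖ ≤ ε * ‖θ - θs‖
  separated : ∀ θ ∈ Θ, ‖φ θ - a‖ ≤ ‖a‖ + γ → θ ∈ N

namespace IdentifiableLinearization

variable {Θ N N₁ : Set V} {θs : V} {φ : V → E} {A : V →L[ℝ] E} {a : E} {c γ : ℝ}

/-- `N₁` is defined so that the remainder consumes at most half of the identifiability slope `c`. -/
lemma linear_growth (h : IdentifiableLinearization Θ N N₁ θs φ A a c γ) {θ : V} (hθ : θ ∈ N₁) :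
    ‖a‖ + c / 2 * ‖θ - θs‖ ≤ ‖a - A (θ - θs)‖ := by
  have h1 := h.identifiable θ (h.subset hθ)
  have h2 := h.remainder_le θ hθ
  have h3 := norm_sub_le (φ θ - A (θ - θs)) (a - A (θ - θs))
  rw [sub_sub_sub_cancel_right] at h3
  linarith

lemma center_mem (h : IdentifiableLinearization Θ N N₁ θs φ A a c γ) : θs ∈ N₁ :=
  mem_of_mem_nhds h.mem_nhds

/-- Dividing the near-minimality inequality by `s` gives `‖φ θ - a‖ ≤ ‖a‖ + (2 * R + 1) / s`, so the
separation property applies. The factor `1` in the bound matches `tendsto_const_div_const_mul_sqrt`.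
-/
lemma mem_of_mem_nearMin (h : IdentifiableLinearization Θ N N₁ θs φ A a c γ) {s R η : ℝ}
    (hs : 0 < s) {z : E} (hz : ‖z‖ ≤ R) (hη : η ≤ 1) (hγ : (2 * R + 1) / (1 * s) ≤ γ) {θ : V}
    (hθ : θ ∈ nearMin φ Θ s (z + s • a) η) : θ ∈ N := by
  refine h.separated θ hθ.1 ?_
  rw [one_mul, div_le_iff₀ hs] at hγ
  have h1 := hθ.2 θs (h.subset_param (h.subset h.center_mem))
  rw [h.center, smul_zero, sub_zero] at h1
  have h2 : ‖s • (φ θ - a)‖ ≤ ‖z + s • a - s • φ θ‖ + ‖z‖ := by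
    rw [← norm_neg (s • (φ θ - a))]
    have := norm_sub_le (z + s • a - s • φ θ) z
    rwa [show z + s • a - s • φ θ - z = -(s • (φ θ - a)) by rw [smul_sub]; abel] at this
  have h3 : ‖z + s • a‖ ≤ ‖z‖ + s * ‖a‖ := by
    refine (norm_add_le _ _).trans ?_
    rw [norm_smul, Real.norm_of_nonneg hs.le]
  rw [norm_smul, Real.norm_of_nonneg hs.le] at h2
  refine le_of_mul_le_mul_left ?_ hs
  linarith

/-- The threshold for `n` does not depend on `z` or `β`, so the conclusion can be used pathwise with
random `z`. -/
lemma eventually_linArgmin [FiniteDimensional ℝ V]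
    (h : IdentifiableLinearization Θ N N₁ θs φ A a c γ) (R : ℝ) :
    ∀ᶠ n : ℕ in atTop, ∀ (z : E) (β : ℝ), ‖z‖ ≤ R → 0 ≤ β → β ≤ 1 →
      (linArgmin A θs N₁ √(n : ℝ) (z + √(n : ℝ) • a) β).Nonempty ∧
      IsCompact (linArgmin A θs N₁ √(n : ℝ) (z + √(n : ℝ) • a) β) ∧
      Convex ℝ (linArgmin A θs N₁ √(n : ℝ) (z + √(n : ℝ) • a) β) ∧
      linArgmin A θs N₁ √(n : ℝ) (z + √(n : ℝ) • a) β
        ⊆ Metric.closedBall θs ((2 * R + 1) / (c / 2 * √(n : ℝ))) := by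
  have hκ := half_pos h.c_pos
  filter_upwards [eventually_closedBall_subset h.mem_nhds (2 * R + 1) (c / 2),
    eventually_gt_atTop 0] with n hn hn0 z β hz hβ0 hβ1
  have hs : 0 < √(n : ℝ) := Real.sqrt_pos.mpr (by exact_mod_cast hn0)
  have hA := fun θ hθ => h.linear_growth (θ := θ) hθ
  exact ⟨linArgmin_nonempty hκ hs hA hz hβ0 hn,
    isCompact_linArgmin hκ hs hA h.center_mem hz hβ1 hn,
    convex_linArgmin hκ hs hA h.center_mem hz hβ1 hn,
    linArgmin_subset_closedBall hκ hs hA h.center_mem hz hβ1⟩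

lemma eventually_nearMin_subset_closedBall
    (h : IdentifiableLinearization Θ N N₁ θs φ A a c γ) (R : ℝ) :
    ∀ᶠ n : ℕ in atTop, ∀ (z : E) (η : ℝ), ‖z‖ ≤ R → η ≤ 1 →
      nearMin φ Θ √(n : ℝ) (z + √(n : ℝ) • a) η
        ⊆ Metric.closedBall θs ((2 * R + 1) / (c * √(n : ℝ))) := by
  filter_upwards [(tendsto_const_div_const_mul_sqrt (2 * R + 1) 1).eventually
    (gt_mem_nhds h.γ_pos), eventually_gt_atTop 0] with n hn hn0 z η hz hη θ hθ
  have hs : 0 < √(n : ℝ) := Real.sqrt_pos.mpr (by exact_mod_cast hn0)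
  have hθN := h.mem_of_mem_nearMin hs hz hη hn.le hθ
  exact mem_closedBall_iff_norm.mpr (norm_sub_le_of_near_min h.c_pos hs h.center
    (h.identifiable θ hθN) hz hη (hθ.2 θs (h.subset_param (h.subset h.center_mem))))

lemma eventually_nearMin_subset_linArgmin
    (h : IdentifiableLinearization Θ N N₁ θs φ A a c γ) {R : ℝ} (hR : 0 ≤ R) {β : ℝ}
    (hβ : 0 < β) :
    ∀ᶠ n : ℕ in atTop, ∀ (z : E) (η : ℝ), ‖z‖ ≤ R → η ≤ min 1 (β / 2) →
      nearMin φ Θ √(n : ℝ) (z + √(n : ℝ) • a) η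
        ⊆ linArgmin A θs N₁ √(n : ℝ) (z + √(n : ℝ) • a) β := by
  have hc := h.c_pos
  -- With this `ε` the two linearisation errors add up to `β / 2`; the other half of `β` absorbs
  -- `η`.
  set ε := β / 2 / (2 * ((2 * R + 1) / (c / 2))) with hεdef
  have hε : 0 < ε := by positivity
  filter_upwards [(tendsto_const_div_const_mul_sqrt (2 * R + 1) 1).eventually
    (gt_mem_nhds h.γ_pos), eventually_closedBall_subset h.mem_nhds (2 * R + 1) (c / 2),
    eventually_closedBall_subset (h.differentiable ε hε) (2 * R + 1) (c / 2),
    eventually_gt_atTop 0] with n hn hball hlin hn0 z η hz hη θ hθ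
  have hs : 0 < √(n : ℝ) := Real.sqrt_pos.mpr (by exact_mod_cast hn0)
  have hθN := h.mem_of_mem_nearMin hs hz (hη.trans (min_le_left _ _)) hn.le hθ
  refine mem_linArgmin_of_near_min hc hs h.center (fun θ hθ => h.linear_growth hθ)
    h.center_mem hz (hη.trans (min_le_left _ _)) hε.le hball (fun θ hθ => hlin hθ) ?_
    (h.identifiable θ hθN) (fun θ' hθ' => hθ.2 θ' (h.subset_param (h.subset hθ')))
  have : 2 * ε * ((2 * R + 1) / (c / 2)) = β / 2 := by
    rw [hεdef]; field_simp
  linarith [hη.trans (min_le_right _ _)]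

end IdentifiableLinearization

end Deterministic

/-! ### From the statistical model to the abstract setting -/

section Bridge

variable {d : ℕ} {V : Type*} [NormedAddCommGroup V]

lemma LMod.normL_le_add_iff {f g : LMod d} {b : ℝ} (hb : 0 ≤ b) :
    normL f.1 ≤ normL g.1 + ENNReal.ofReal b ↔ ‖f‖ ≤ ‖g‖ + b := by
  rw [f.normL_eq, g.normL_eq, ← ENNReal.ofReal_add (norm_nonneg _) hb,
    ENNReal.ofReal_le_ofReal_iff (by positivity)]

lemma le_biInf_add_iff {ι : Type*} {S : Set ι} {f : ι → ℝ≥0∞} {x b : ℝ≥0∞} :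
    x ≤ (⨅ i ∈ S, f i) + b ↔ ∀ i ∈ S, x ≤ f i + b := by
  simp only [ENNReal.iInf_add, le_iInf_iff]

lemma nearArgmin_eq_linArgmin [NormedSpace ℝ V] {D : USphere d → ℝ → StrongDual ℝ V} {A : V →L[ℝ] LMod d}
    (hA : ∀ v, (A v).1 = fun u t => D u t v) (θs : V) (N₁ : Set V) (n : ℕ) (x : LMod d)
    (β : ℝ≥0) :
    nearArgmin D θs N₁ n x.1 β = linArgmin A θs N₁ √(n : ℝ) x β := by
  have hres (θ : V) : linResidual D θs n x.1 θ = (x - √(n : ℝ) • A (θ - θs)).1 := by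
    rw [show (x - √(n : ℝ) • A (θ - θs)).1 = x.1 - √(n : ℝ) • (A (θ - θs)).1 from rfl, hA]
    rfl
  ext θ
  simp only [nearArgmin, linArgmin, hres, Set.mem_ofPred_eq, le_biInf_add_iff]
  refine and_congr_right fun _ => forall₂_congr fun θ' _ => ?_
  rw [← ENNReal.ofReal_coe_nnreal]
  exact LMod.normL_le_add_iff β.2

/-- Multiplying the criterion by `√n` turns the tolerance `e / √n` into `e`. -/
lemma approxEstimators_subset_nearMin {V : Type*} {Θ : Set V} {μ : V → ProbabilityMeasure (Space d)}
    {φ : V → LMod d} {x : ℕ → Space d} {n : ℕ} (hn : 0 < n)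
    {y : LMod d} (hy : ∀ θ ∈ Θ, (y - √(n : ℝ) • φ θ).1
      = √(n : ℝ) • (empCDF x n - projCDF (μ θ : Measure (Space d)))) {e : ℝ} (he : 0 ≤ e) :
    approxEstimators Θ μ x n e ⊆ nearMin φ Θ √(n : ℝ) y e := by
  have hs : 0 < √(n : ℝ) := Real.sqrt_pos.mpr (by exact_mod_cast hn)
  have := isProbabilityMeasure_empMeasure x hn.ne'
  have key : ∀ θ ∈ Θ, normL (y - √(n : ℝ) • φ θ).1
      = ENNReal.ofReal √(n : ℝ) * maxSW (empMeasure x n) (μ θ) := by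
    intro θ hθ
    rw [hy θ hθ, normL_smul, maxSW_eq_normL, projCDF_empMeasure,
      Real.enorm_of_nonneg hs.le]
  rintro θ ⟨hθ, h⟩
  rw [le_biInf_add_iff] at h
  refine ⟨hθ, fun θ' hθ' => ?_⟩
  rw [← LMod.normL_le_add_iff he, key θ hθ, key θ' hθ']
  refine (mul_le_mul_right (h θ' hθ') (ENNReal.ofReal √(n : ℝ))).trans_eq ?_
  rw [mul_add, ← ENNReal.ofReal_mul hs.le, mul_div_cancel₀ _ hs.ne']

lemma hausdorffEDist_linImage_le [NormedSpace ℝ V] {D : USphere d → ℝ → StrongDual ℝ V} {A : V →L[ℝ] LMod d}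
    (hA : ∀ v, (A v).1 = fun u t => D u t v) {θs : V} {s t : Set V} {r : ℝ} (hs : s.Nonempty)
    (ht : t.Nonempty) (hsr : s ⊆ Metric.closedBall θs r) (htr : t ⊆ Metric.closedBall θs r) :
    Metric.hausdorffEDist (linImage D θs s) (linImage D θs t)
      ≤ ENNReal.ofReal (‖A‖ * (2 * r)) := by
  have key {f g : LSpace d} {x y : V} (hx : x ∈ Metric.closedBall θs r)
      (hy : y ∈ Metric.closedBall θs r) (hf : ∀ u t, f.1 u t = D u t (x - θs))
      (hg : ∀ u t, g.1 u t = D u t (y - θs)) : edist f g ≤ ENNReal.ofReal (‖A‖ * (2 * r)) := by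
    have h1 : f.1 - g.1 = (A (x - y)).1 := by
      ext u t
      rw [hA, Pi.sub_apply, Pi.sub_apply, hf, hg, ← map_sub, sub_sub_sub_cancel_right]
    change normL (f.1 - g.1) ≤ _
    rw [h1, LMod.normL_eq]
    refine ENNReal.ofReal_le_ofReal ((A.le_opNorm _).trans ?_)
    gcongr
    rw [← dist_eq_norm]
    linarith [dist_triangle_right x y θs, Metric.mem_closedBall.mp hx, Metric.mem_closedBall.mp hy]
  have himage (x : V) : ∃ f : LSpace d, ∀ u t, f.1 u t = D u t (x - θs) :=
    ⟨⟨(A (x - θs)).1, (A (x - θs)).2⟩, fun u t => by simp only [hA]⟩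
  obtain ⟨x₀, hx₀⟩ := hs
  obtain ⟨y₀, hy₀⟩ := ht
  refine Metric.hausdorffEDist_le_of_mem_edist ?_ ?_
  · rintro f ⟨x, hx, hf⟩
    obtain ⟨g, hg⟩ := himage y₀
    exact ⟨g, ⟨y₀, hy₀, hg⟩, key (hsr hx) (htr hy₀) hf hg⟩
  · rintro f ⟨y, hy, hf⟩
    obtain ⟨g, hg⟩ := himage x₀
    exact ⟨g, ⟨x₀, hx₀, hg⟩, key (htr hy) (hsr hx₀) hf hg⟩

/-- The model of distribution functions, as an identifiable linearisation in `L`. -/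
lemma exists_identifiableLinearization [NormedSpace ℝ V] [FiniteDimensional ℝ V] {Θ : Set V} {θs : V}
    (hθs : θs ∈ interior Θ) {μ : V → ProbabilityMeasure (Space d)}
    (hμ : ∀ θ ∈ Θ, Integrable (fun y => ‖y‖) (μ θ : Measure (Space d)))
    {μs : ProbabilityMeasure (Space d)}
    (hμs : Integrable (fun y => ‖y‖) (μs : Measure (Space d))) (hcont : ContinuousOn μ Θ)
    (hτ : ∃ τ : ℝ, 0 < τ ∧ Bornology.IsBounded (popNearArgmin Θ μ μs τ) ∧
      closure (popNearArgmin Θ μ μs τ) ⊆ Θ)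
    (hmin : ∀ θ ∈ Θ, θ ≠ θs →
      maxSW (μs : Measure (Space d)) (μ θs) < maxSW (μs : Measure (Space d)) (μ θ))
    {D : USphere d → ℝ → StrongDual ℝ V} (hD : Measurable (Function.uncurry D))
    (hrem : ∀ ε : ℝ, 0 < ε → ∀ᶠ θ in 𝓝[Θ] θs,
      normL (remainder μ θs D θ) ≤ ENNReal.ofReal (ε * ‖θ - θs‖))
    {N : Set V} (hN : N ∈ 𝓝 θs) (hNΘ : N ⊆ Θ) {c : ℝ} (hc : 0 < c)
    (hid : ∀ θ ∈ N, maxSW (μ θs : Measure (Space d)) μs + ENNReal.ofReal (c * ‖θ - θs‖)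
      ≤ maxSW (μ θ : Measure (Space d)) μs) :
    ∃ (φ : V → LMod d) (A : V →L[ℝ] LMod d) (a : LMod d) (γ : ℝ),
      IdentifiableLinearization Θ N (localSet μ θs D N c) θs φ A a c γ ∧
      (∀ v, (A v).1 = fun u t => D u t v) ∧
      (∀ θ ∈ Θ, (φ θ).1 = projCDF (μ θ : Measure (Space d)) - projCDF (μ θs : Measure (Space d))) ∧
      a.1 = projCDF (μs : Measure (Space d)) - projCDF (μ θs : Measure (Space d)) := by
  have hΘ : Θ ∈ 𝓝 θs := mem_interior_iff_mem_nhds.mp hθs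
  have hθs' : θs ∈ Θ := interior_subset hθs
  let a : LMod d := ⟨_, projCDF_sub_mem μs (μ θs) hμs (hμ θs hθs')⟩
  -- Outside `Θ` no first moment is assumed, so the difference may leave `L`; the value `0` there is
  -- a filler.
  have hφ (θ : V) : ∃ f : LMod d, θ ∈ Θ →
      f.1 = projCDF (μ θ : Measure (Space d)) - projCDF (μ θs : Measure (Space d)) := by
    by_cases h : θ ∈ Θ
    · exact ⟨⟨_, projCDF_sub_mem (μ θ) (μ θs) (hμ θ h) (hμ θs hθs')⟩, fun _ => rfl⟩
    · exact ⟨0, fun h' => absurd h' h⟩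
  choose φ hφ using hφ
  let A' : V →ₗ[ℝ] LMod d :=
    { toFun := fun v => ⟨_, derivative_apply_mem hθs hμ hD
        ((hrem 1 one_pos).mono fun θ h => h.trans_lt ENNReal.ofReal_lt_top) v⟩
      map_add' := fun v w => Subtype.ext (by ext u t; exact map_add (D u t) v w)
      map_smul' := fun r v => Subtype.ext (by ext u t; exact map_smul (D u t) r v) }
  -- No uniform bound on `D` is assumed: continuity comes from the finite dimension of `V`.
  let A : V →L[ℝ] LMod d := ⟨A', A'.continuous_of_finiteDimensional⟩
  have hA (v : V) : (A v).1 = fun u t => D u t v := rfl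
  have hR (θ : V) (hθ : θ ∈ Θ) :
      normL (remainder μ θs D θ) = ENNReal.ofReal ‖φ θ - A (θ - θs)‖ := by
    rw [← LMod.normL_eq, show (φ θ - A (θ - θs)).1 = (φ θ).1 - (A (θ - θs)).1 from rfl,
      hφ θ hθ, hA]
    rfl
  have ha : maxSW (μ θs : Measure (Space d)) μs = ENNReal.ofReal ‖a‖ := by
    rw [maxSW_comm, maxSW_eq_normL, ← LMod.normL_eq]
  have hdist (θ : V) (hθ : θ ∈ Θ) :
      maxSW (μ θ : Measure (Space d)) μs = ENNReal.ofReal ‖φ θ - a‖ := by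
    rw [maxSW_eq_normL, ← LMod.normL_eq, show (φ θ - a).1 = (φ θ).1 - a.1 from rfl, hφ θ hθ,
      sub_sub_sub_cancel_right]
  have hrem' (ε : ℝ) (hε : 0 < ε) : ∀ᶠ θ in 𝓝 θs,
      normL (remainder μ θs D θ) ≤ ENNReal.ofReal (ε * ‖θ - θs‖) := by
    rw [← nhdsWithin_eq_nhds.mpr hΘ]
    exact hrem ε hε
  obtain ⟨γ, hγ, hsep⟩ := exists_maxSW_le_imp_mem hcont hθs'
    (by rw [maxSW_comm, ha]; exact ENNReal.ofReal_ne_top) hτ hmin hN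
  refine ⟨φ, A, a, γ, ⟨hc, hγ, ?_, fun θ h => h.1, hNΘ, ?_, fun θ hθ => ?_, fun θ hθ => ?_,
    fun ε hε => ?_, fun θ hθ h => ?_⟩, hA, hφ, rfl⟩
  · exact Subtype.ext ((hφ θs hθs').trans (sub_self _))
  · filter_upwards [hN, hrem' (c / 2) (half_pos hc)] with θ h1 h2 using ⟨h1, h2⟩
  · have h := hid θ hθ
    rwa [ha, hdist θ (hNΘ hθ), ← ENNReal.ofReal_add (norm_nonneg _) (by positivity),
      ENNReal.ofReal_le_ofReal_iff (norm_nonneg _)] at h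
  · have h := hθ.2
    rwa [hR θ (hNΘ hθ.1), ENNReal.ofReal_le_ofReal_iff (by positivity)] at h
  · filter_upwards [hrem' ε hε, hΘ] with θ h hθ
    rwa [hR θ hθ, ENNReal.ofReal_le_ofReal_iff (by positivity)] at h
  · refine hsep θ hθ ?_
    rw [maxSW_comm, hdist θ hθ, maxSW_comm, ha, ← ENNReal.ofReal_add (norm_nonneg _) hγ.le]
    exact ENNReal.ofReal_le_ofReal h

end Bridge

/-! ### Inner probability and the diagonal argument -/

section InnerProbability

variable {Ω : Type*} [MeasurableSpace Ω] {P : Measure Ω}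

lemma innerProb_le_one [IsProbabilityMeasure P] (A : Set Ω) : innerProb P A ≤ 1 :=
  iSup₂_le fun _ _ => prob_le_one

lemma measure_le_innerProb {A B : Set Ω} (hA : NullMeasurableSet A P) (h : A ⊆ B) :
    P A ≤ innerProb P B := by
  obtain ⟨C, hCA, hC, hae⟩ := hA.exists_measurable_subset_ae_eq
  rw [← measure_congr hae]
  exact le_iSup₂_of_le C ⟨hC, hCA.trans h⟩ le_rfl

lemma tendsto_one_of_forall_le {h : ℕ → ℝ≥0∞} (h1 : ∀ n, h n ≤ 1)
    (hδ : ∀ δ : ℝ, 0 < δ → ∀ᶠ n in atTop, ENNReal.ofReal (1 - δ) ≤ h n) :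
    Tendsto h atTop (𝓝 1) := by
  refine tendsto_order.mpr ⟨fun b hb => ?_, fun b hb => .of_forall fun n => (h1 n).trans_lt hb⟩
  have hlim : Tendsto (fun δ : ℝ => ENNReal.ofReal (1 - δ)) (𝓝[>] 0) (𝓝 1) := by
    have : Tendsto (fun δ : ℝ => ENNReal.ofReal (1 - δ)) (𝓝 0) (𝓝 (ENNReal.ofReal (1 - 0))) :=
      (ENNReal.continuous_ofReal.comp (continuous_const.sub continuous_id)).tendsto 0
    simpa using this.mono_left nhdsWithin_le_nhds
  obtain ⟨δ, hbδ, hδ0⟩ := ((hlim.eventually (lt_mem_nhds hb)).and self_mem_nhdsWithin).exists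
  filter_upwards [hδ δ hδ0] with n hn using hbδ.trans_le hn

/-- Diagonal argument: `κ n` is the largest `k ≤ n` whose threshold `m k` has been passed. From `m
0` on, `k = 0` qualifies, so the search succeeds. -/
lemma exists_tendsto_atTop_of_forall_eventually {p : ℕ → ℕ → Prop}
    (h : ∀ k, ∀ᶠ n in atTop, p k n) :
    ∃ κ : ℕ → ℕ, Tendsto κ atTop atTop ∧ ∀ᶠ n in atTop, p (κ n) n := by
  classical
  choose m hm using fun k => eventually_atTop.mp (h k)
  refine ⟨fun n => Nat.findGreatest (fun k => m k ≤ n) n, tendsto_atTop.mpr fun k => ?_, ?_⟩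
  · filter_upwards [eventually_ge_atTop (max k (m k))] with n hn
    exact Nat.le_findGreatest ((le_max_left _ _).trans hn) ((le_max_right _ _).trans hn)
  · filter_upwards [eventually_ge_atTop (m 0)] with n hn
    exact hm _ n (Nat.findGreatest_spec (P := fun k => m k ≤ n) (Nat.zero_le n) hn)

end InnerProbability

/-! ### Tightness of the empirical process -/

section Tightness

variable {d : ℕ} {Ω : Type*} [MeasurableSpace Ω] {P : Measure Ω}

lemma isClosed_le_normL (R : ℝ≥0∞) : IsClosed {f : LSpace d | R ≤ normL f.1} := by
  let f₀ : LSpace d := ⟨0, fun _ => integrable_zero _ _ _, by simp [normL]⟩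
  have : {f : LSpace d | R ≤ normL f.1} = {f | R ≤ edist f f₀} := by
    ext f
    change _ ↔ R ≤ normL (f.1 - 0)
    rw [sub_zero]
    rfl
  rw [this]
  exact isClosed_le continuous_const (continuous_id.edist continuous_const)

/-- Each element of `L` has finite norm, so these sets decrease to the empty set. The measure is
finite, hence continuous from above. -/
lemma exists_measure_le_normL_lt [IsProbabilityMeasure P] {G : Ω → LSpace d}
    (hG : AEMeasurable G P) {ε : ℝ≥0∞} (hε : 0 < ε) :
    ∃ R : ℕ, P.map G {f | (R : ℝ≥0∞) ≤ normL f.1} < ε := by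
  have := Measure.isProbabilityMeasure_map hG
  have hanti : Antitone fun R : ℕ => {f : LSpace d | (R : ℝ≥0∞) ≤ normL f.1} :=
    fun R S h f (hf : (S : ℝ≥0∞) ≤ _) => le_trans (by exact_mod_cast h) hf
  have hlim := tendsto_measure_iInter_atTop (μ := P.map G)
    (fun R : ℕ => (isClosed_le_normL (d := d) R).measurableSet.nullMeasurableSet) hanti
    ⟨0, measure_ne_top _ _⟩
  have hem : ⋂ R : ℕ, {f : LSpace d | (R : ℝ≥0∞) ≤ normL f.1} = ∅ := by
    refine Set.eq_empty_of_forall_notMem fun f hf => ?_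
    obtain ⟨R, hR⟩ := ENNReal.exists_nat_gt f.2.2.ne
    exact absurd (Set.mem_iInter.mp hf R) (not_le.mpr hR)
  rw [hem, measure_empty] at hlim
  exact (hlim.eventually (gt_mem_nhds hε)).exists

/-- Tightness of an empirical process that converges in distribution in `L`. -/
lemma exists_forall_eventually_le_measure [IsProbabilityMeasure P] {Z : ℕ → Ω → LSpace d}
    {G : Ω → LSpace d} (hZ : TendstoInDistribution Z atTop G (fun _ => P) P)
    {η : ℕ → Ω → ℝ} (hηm : ∀ n, Measurable (η n))
    (hη : ∀ᵐ ω ∂P, Tendsto (fun n => η n ω) atTop (𝓝 0)) {δ : ℝ} (hδ : 0 < δ) :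
    ∃ R : ℕ, ∀ e : ℝ, 0 < e → ∀ᶠ n in atTop,
      NullMeasurableSet {ω | normL (Z n ω).1 ≤ R ∧ normL (G ω).1 ≤ R ∧ η n ω ≤ e} P ∧
      ENNReal.ofReal (1 - δ) ≤ P {ω | normL (Z n ω).1 ≤ R ∧ normL (G ω).1 ≤ R ∧ η n ω ≤ e} := by
  have hδ3 : 0 < ENNReal.ofReal (δ / 3) := ENNReal.ofReal_pos.mpr (by positivity)
  obtain ⟨R, hR⟩ := exists_measure_le_normL_lt hZ.aemeasurable_limit hδ3
  refine ⟨R, fun e he => ?_⟩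
  have hF : MeasurableSet {f : LSpace d | (R : ℝ≥0∞) ≤ normL f.1} :=
    (isClosed_le_normL R).measurableSet
  have hlt {Y : Ω → LSpace d} (hY : AEMeasurable Y P)
      (h : P.map Y {f | (R : ℝ≥0∞) ≤ normL f.1} < ENNReal.ofReal (δ / 3)) :
      P {ω | (R : ℝ≥0∞) < normL (Y ω).1} ≤ ENNReal.ofReal (δ / 3) := by
    rw [Measure.map_apply_of_aemeasurable hY hF] at h
    refine le_trans (measure_mono fun ω hω => ?_) h.le
    exact le_of_lt (show (R : ℝ≥0∞) < normL (Y ω).1 from hω)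
  have hnull {Y : Ω → LSpace d} (hY : AEMeasurable Y P) :
      NullMeasurableSet {ω | normL (Y ω).1 ≤ R} P := by
    have hm : Measurable fun f : LSpace d => normL f.1 :=
      measurable_of_Ici fun r => (isClosed_le_normL r).measurableSet
    exact (hm.comp_aemeasurable hY).nullMeasurable measurableSet_Iic
  -- Portmanteau for the closed set `R ≤ normL` transfers the tail bound from the limit to the
  -- process. The budget `δ` is split in three, between `Z n`, `G` and `η n`.
  have hlimsup := ProbabilityMeasure.limsup_measure_closed_le_of_tendsto hZ.tendsto
    (isClosed_le_normL (d := d) R)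
  have hηlim := tendstoInMeasure_of_tendsto_ae (fun n => (hηm n).aestronglyMeasurable) hη
    (ENNReal.ofReal e) (ENNReal.ofReal_pos.mpr he)
  filter_upwards [eventually_lt_of_limsup_lt (hlimsup.trans_lt hR),
    hηlim.eventually (gt_mem_nhds hδ3)] with n hn hηn
  have hS : NullMeasurableSet {ω | normL (Z n ω).1 ≤ R ∧ normL (G ω).1 ≤ R ∧ η n ω ≤ e} P :=
    (hnull (hZ.forall_aemeasurable n)).inter ((hnull hZ.aemeasurable_limit).inter
      (measurableSet_le (hηm n) measurable_const).nullMeasurableSet)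
  refine ⟨hS, ?_⟩
  have hcompl : P {ω | normL (Z n ω).1 ≤ R ∧ normL (G ω).1 ≤ R ∧ η n ω ≤ e}ᶜ
      ≤ ENNReal.ofReal δ := by
    have hsub : {ω | normL (Z n ω).1 ≤ R ∧ normL (G ω).1 ≤ R ∧ η n ω ≤ e}ᶜ
        ⊆ {ω | (R : ℝ≥0∞) < normL (Z n ω).1} ∪ ({ω | (R : ℝ≥0∞) < normL (G ω).1} ∪
          {ω | ENNReal.ofReal e ≤ edist (η n ω) 0}) := by
      intro ω hω
      by_contra! h
      simp only [Set.mem_union, Set.mem_ofPred_eq, not_or, not_lt, not_le] at h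
      refine hω ⟨h.1, h.2.1, ?_⟩
      have h3 := h.2.2
      rw [edist_dist, Real.dist_eq, sub_zero, ENNReal.ofReal_lt_ofReal_iff he] at h3
      exact (le_abs_self _).trans h3.le
    calc _ ≤ ENNReal.ofReal (δ / 3) + (ENNReal.ofReal (δ / 3) + ENNReal.ofReal (δ / 3)) :=
          (measure_mono hsub).trans ((measure_union_le _ _).trans (add_le_add
            (hlt (hZ.forall_aemeasurable n) hn) ((measure_union_le _ _).trans
              (add_le_add (hlt hZ.aemeasurable_limit hR) hηn.le))))
      _ = ENNReal.ofReal δ := by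
          rw [← ENNReal.ofReal_add (by positivity) (by positivity),
            ← ENNReal.ofReal_add (by positivity) (by positivity)]
          congr 1; ring
  rw [ENNReal.ofReal_sub _ hδ.le, ENNReal.ofReal_one, tsub_le_iff_right]
  calc 1 = P Set.univ := measure_univ.symm
    _ ≤ _ := by
      rw [← Set.union_compl_self {ω | normL (Z n ω).1 ≤ R ∧ normL (G ω).1 ≤ R ∧ η n ω ≤ e}]
      exact (measure_union_le _ _).trans (add_le_add_right hcompl _)

end Tightness

end MaxSliced

/-! ### The main theorem -/

theorem mainTheorem1
    {d : ℕ} (hd : 0 < d)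
    -- parameter space `V` and parameter set `Θ`
    {V : Type*} [NormedAddCommGroup V] [NormedSpace ℝ V] [FiniteDimensional ℝ V]
    (Θ : Set V) (θs : V) (hθs : θs ∈ interior Θ)
    -- the model and the data-generating measure, all with finite first moment
    (μ : V → ProbabilityMeasure (MaxSliced.Space d))
    (hμ : ∀ θ ∈ Θ, Integrable (fun y => ‖y‖) (μ θ : Measure (MaxSliced.Space d)))
    (μs : ProbabilityMeasure (MaxSliced.Space d))
    (hμs : Integrable (fun y => ‖y‖) (μs : Measure (MaxSliced.Space d)))
    -- the data
    {Ω : Type*} [MeasurableSpace Ω] (P : Measure Ω) [IsProbabilityMeasure P]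
    (X : ℕ → Ω → MaxSliced.Space d) (hX : ∀ i, Measurable (X i))
    -- convergence of the empirical measures
    (hA1 : ∀ᵐ ω ∂P, Tendsto
      (fun n => MaxSliced.wasserstein (MaxSliced.empMeasure (fun i => X i ω) n)
        (μs : Measure (MaxSliced.Space d))) atTop (𝓝 0))
    -- weak continuity of the model
    (hA2 : ContinuousOn μ Θ)
    -- boundedness of some population near-argmin set, whose closure stays in `Θ`
    (hA3 : ∃ τ : ℝ, 0 < τ ∧ Bornology.IsBounded (MaxSliced.popNearArgmin Θ μ μs τ) ∧
      closure (MaxSliced.popNearArgmin Θ μ μs τ) ⊆ Θ)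
    -- `θs` is the unique minimiser of the population criterion
    (hmin : ∀ θ ∈ Θ, θ ≠ θs →
      MaxSliced.maxSW (μs : Measure (MaxSliced.Space d)) (μ θs)
        < MaxSliced.maxSW (μs : Measure (MaxSliced.Space d)) (μ θ))
    -- linearisation of the projected distribution functions at `θs`
    (D : MaxSliced.USphere d → ℝ → StrongDual ℝ V) (hD : Measurable (Function.uncurry D))
    (hA7 : ∀ ε : ℝ, 0 < ε → ∀ᶠ θ in 𝓝[Θ] θs,
      MaxSliced.normL (MaxSliced.remainder μ θs D θ) ≤ ENNReal.ofReal (ε * ‖θ - θs‖))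
    -- weak convergence of the empirical process
    (G : Ω → MaxSliced.LSpace d)
    (hA8 : TendstoInDistribution
      (fun n ω => MaxSliced.empProcess (μs : Measure (MaxSliced.Space d)) hμs (fun i => X i ω) n)
      atTop G (fun _ => P) P)
    -- local strong identifiability
    (N : Set V) (hN : N ∈ 𝓝 θs) (hNΘ : N ⊆ Θ) (c : ℝ) (hc : 0 < c)
    (hA9 : ∀ θ ∈ N, MaxSliced.maxSW (μ θs : Measure (MaxSliced.Space d)) μs
      + ENNReal.ofReal (c * ‖θ - θs‖) ≤ MaxSliced.maxSW (μ θ : Measure (MaxSliced.Space d)) μs)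
    -- the tolerances of the approximate estimators
    (η : ℕ → Ω → ℝ) (hηmeas : ∀ n, Measurable (η n)) (hηpos : ∀ n ω, 0 < η n ω)
    (hη : ∀ᵐ ω ∂P, Tendsto (fun n => η n ω) atTop (𝓝 0)) :
    let N₁ : Set V := MaxSliced.localSet μ θs D N c
    let M : ℕ → Ω → Set V := fun n ω =>
      MaxSliced.approxEstimators Θ μ (fun i => X i ω) n (η n ω)
    let K : ℝ≥0 → ℕ → Ω → Set V := fun b n ω =>
      MaxSliced.nearArgmin D θs N₁ n (MaxSliced.empG μ θs (fun i => X i ω) n) b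
    let Ks : ℕ → Ω → Set V := fun n ω =>
      MaxSliced.nearArgmin D θs N₁ n (MaxSliced.limG μ θs μs (G ω) n) 0
    ∃ β : ℕ → ℝ≥0, Tendsto β atTop (𝓝 0) ∧
      -- the approximate estimators are near-minimisers of the surrogate
      Tendsto (fun n => MaxSliced.innerProb P {ω | M n ω ⊆ K (β n) n ω}) atTop (𝓝 1) ∧
      -- the two near-argmin sets are nonempty, compact and convex
      Tendsto (fun n => MaxSliced.innerProb P {ω |
        (Ks n ω).Nonempty ∧ IsCompact (Ks n ω) ∧ Convex ℝ (Ks n ω) ∧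
        (K (β n) n ω).Nonempty ∧ IsCompact (K (β n) n ω) ∧ Convex ℝ (K (β n) n ω)})
        atTop (𝓝 1) ∧
      -- they are close in the Hausdorff distance, both for the norm of the parameters and
      -- for `‖·‖_L` after the embedding `θ ↦ ⟨θ - θs, D⟩`
      (∀ ε : ℝ, 0 < ε → Tendsto (fun n => MaxSliced.innerProb P {ω |
        Metric.hausdorffEDist (Ks n ω) (K (β n) n ω) < ENNReal.ofReal ε ∧
        Metric.hausdorffEDist (MaxSliced.linImage D θs (Ks n ω))
          (MaxSliced.linImage D θs (K (β n) n ω)) < ENNReal.ofReal ε}) atTop (𝓝 1)) ∧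
      -- the rate `n ^ (-1/2)`
      (∀ δ : ℝ, 0 < δ → ∃ C : ℝ, ∀ᶠ n : ℕ in atTop,
        ENNReal.ofReal (1 - δ) ≤ MaxSliced.innerProb P {ω |
          M n ω ⊆ Metric.closedBall θs (C / √(n : ℝ)) ∧
          Metric.hausdorffEDist (Ks n ω) (K (β n) n ω) ≤ ENNReal.ofReal (C / √(n : ℝ))}) := by
  intro N₁ M K Ks
  obtain ⟨φ, A, a, γ, hL, hAD, hφ, ha⟩ := MaxSliced.exists_identifiableLinearization hθs hμ hμs
    hA2 hA3 hmin hD hA7 hN hNΘ hc hA9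
  let Z : ℕ → Ω → MaxSliced.LSpace d := fun n ω =>
    MaxSliced.empProcess (μs : Measure (MaxSliced.Space d)) hμs (fun i => X i ω) n
  let z : ℕ → Ω → MaxSliced.LMod d := fun n ω => ⟨(Z n ω).1, (Z n ω).2⟩
  let g : Ω → MaxSliced.LMod d := fun ω => ⟨(G ω).1, (G ω).2⟩
  have hKs (n : ℕ) (ω : Ω) : Ks n ω =
      MaxSliced.linArgmin A θs N₁ √(n : ℝ) (g ω + √(n : ℝ) • a) 0 := by
    have h : MaxSliced.limG μ θs μs (G ω) n = (g ω + √(n : ℝ) • a).1 := by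
      rw [show (g ω + √(n : ℝ) • a).1 = (G ω).1 + √(n : ℝ) • a.1 from rfl, ha]
      rfl
    change MaxSliced.nearArgmin D θs N₁ n (MaxSliced.limG μ θs μs (G ω) n) 0 = _
    rw [h]
    exact MaxSliced.nearArgmin_eq_linArgmin hAD θs N₁ n _ 0
  have hK (b : ℝ≥0) (n : ℕ) (ω : Ω) : K b n ω =
      MaxSliced.linArgmin A θs N₁ √(n : ℝ) (z n ω + √(n : ℝ) • a) b := by
    have h : MaxSliced.empG μ θs (fun i => X i ω) n = (z n ω + √(n : ℝ) • a).1 := by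
      rw [show (z n ω + √(n : ℝ) • a).1 = (Z n ω).1 + √(n : ℝ) • a.1 from rfl, ha]
      ext u t
      simp only [MaxSliced.empG, Z, MaxSliced.empProcess, Pi.add_apply, Pi.smul_apply,
        Pi.sub_apply, smul_eq_mul]
      ring
    change MaxSliced.nearArgmin D θs N₁ n (MaxSliced.empG μ θs (fun i => X i ω) n) b = _
    rw [h]
    exact MaxSliced.nearArgmin_eq_linArgmin hAD θs N₁ n _ b
  have hM {n : ℕ} (hn : 0 < n) (ω : Ω) :
      M n ω ⊆ MaxSliced.nearMin φ Θ √(n : ℝ) (z n ω + √(n : ℝ) • a) (η n ω) := by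
    refine MaxSliced.approxEstimators_subset_nearMin hn (fun θ hθ => ?_) (hηpos n ω).le
    rw [show (z n ω + √(n : ℝ) • a - √(n : ℝ) • φ θ).1
      = (Z n ω).1 + √(n : ℝ) • a.1 - √(n : ℝ) • (φ θ).1 from rfl, ha, hφ θ hθ]
    ext u t
    simp only [Z, MaxSliced.empProcess, Pi.add_apply, Pi.smul_apply, Pi.sub_apply, smul_eq_mul]
    ring
  have hnorm {R : ℕ} {f : MaxSliced.LMod d} (h : MaxSliced.normL f.1 ≤ R) : ‖f‖ ≤ R := by
    rw [f.normL_eq] at h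
    simpa using ENNReal.toReal_mono (ENNReal.natCast_ne_top R) h
  have htight (δ : ℝ) (hδ : 0 < δ) := MaxSliced.exists_forall_eventually_le_measure hA8 hηmeas hη hδ
  -- a localisation event of large probability carries over to any event that contains it
  have hprob {δ : ℝ} {R : ℕ} {e : ℝ} {B : ℕ → Set Ω}
      (hR : ∀ᶠ n in atTop,
        NullMeasurableSet {ω | MaxSliced.normL (Z n ω).1 ≤ R ∧ MaxSliced.normL (G ω).1 ≤ R ∧
          η n ω ≤ e} P ∧
        ENNReal.ofReal (1 - δ) ≤ P {ω | MaxSliced.normL (Z n ω).1 ≤ R ∧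
          MaxSliced.normL (G ω).1 ≤ R ∧ η n ω ≤ e})
      (hB : ∀ᶠ n in atTop, ∀ ω, ‖z n ω‖ ≤ R → ‖g ω‖ ≤ R → η n ω ≤ e → ω ∈ B n) :
      ∀ᶠ n in atTop, ENNReal.ofReal (1 - δ) ≤ MaxSliced.innerProb P (B n) := by
    filter_upwards [hR, hB] with n hn hBn
    exact hn.2.trans (MaxSliced.measure_le_innerProb hn.1 fun ω hω =>
      hBn ω (hnorm hω.1) (hnorm hω.2.1) hω.2.2)
  have hsub (b : ℝ≥0) (hb : 0 < b) :
      Tendsto (fun n => MaxSliced.innerProb P {ω | M n ω ⊆ K b n ω}) atTop (𝓝 1) := by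
    refine MaxSliced.tendsto_one_of_forall_le (fun n => MaxSliced.innerProb_le_one _)
      fun δ hδ => ?_
    obtain ⟨R, hR⟩ := htight δ hδ
    have hb' : (0 : ℝ) < b := hb
    refine hprob (hR (min 1 (b / 2)) (by positivity)) ?_
    filter_upwards [hL.eventually_nearMin_subset_linArgmin R.cast_nonneg hb',
      eventually_gt_atTop 0] with n hn hn0 ω hz _ hηω
    exact (hM hn0 ω).trans ((hn _ _ hz hηω).trans_eq (hK b n ω).symm)
  -- For each fixed `b > 0` the inclusion has probability tending to one. The diagonal lets `b = 1 /
  -- (k + 1)`, which also bounds the failure probability, decrease slowly with `n`.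
  obtain ⟨κ, hκ, hκsub⟩ := MaxSliced.exists_tendsto_atTop_of_forall_eventually
    (p := fun k n => ENNReal.ofReal (1 - 1 / ((k : ℝ) + 1))
      ≤ MaxSliced.innerProb P {ω | M n ω ⊆ K (1 / ((k : ℝ≥0) + 1)) n ω}) fun k => by
    have h1 : ENNReal.ofReal (1 - 1 / ((k : ℝ) + 1)) < 1 := by
      rw [ENNReal.ofReal_lt_one]
      linarith [Nat.one_div_pos_of_nat (α := ℝ) (n := k)]
    filter_upwards [(hsub (1 / ((k : ℝ≥0) + 1)) (by positivity)).eventually (lt_mem_nhds h1)]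
      with n hn using hn.le
  let β : ℕ → ℝ≥0 := fun n => 1 / ((κ n : ℝ≥0) + 1)
  have hβ1 (n : ℕ) : (β n : ℝ) ≤ 1 := by
    have : β n ≤ 1 := div_le_one_of_le₀ (by simp) (by positivity)
    exact_mod_cast this
  -- on the localisation event, both near-argmin sets are regular and close to `θs`
  have hreg (R : ℕ) : ∀ᶠ n : ℕ in atTop, ∀ ω, ‖z n ω‖ ≤ R → ‖g ω‖ ≤ R →
      ((Ks n ω).Nonempty ∧ IsCompact (Ks n ω) ∧ Convex ℝ (Ks n ω) ∧
        Ks n ω ⊆ Metric.closedBall θs ((2 * R + 1) / (c / 2 * √(n : ℝ)))) ∧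
      (K (β n) n ω).Nonempty ∧ IsCompact (K (β n) n ω) ∧ Convex ℝ (K (β n) n ω) ∧
        K (β n) n ω ⊆ Metric.closedBall θs ((2 * R + 1) / (c / 2 * √(n : ℝ))) := by
    filter_upwards [hL.eventually_linArgmin R] with n hn ω hz hg
    rw [hKs, hK]
    exact ⟨hn _ 0 hg le_rfl zero_le_one, hn _ _ hz (β n).2 (hβ1 n)⟩
  refine ⟨β, ?_, ?_, ?_, fun ε hε => ?_, fun δ hδ => ?_⟩
  · exact (tendsto_one_div_add_atTop_nhds_zero_nat (𝕜 := ℝ≥0)).comp hκ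
  · have hlim : Tendsto (fun n => ENNReal.ofReal (1 - 1 / ((κ n : ℝ) + 1))) atTop (𝓝 1) := by
      have h := (tendsto_one_div_add_atTop_nhds_zero_nat (𝕜 := ℝ)).comp hκ
      simpa using ENNReal.tendsto_ofReal (h.const_sub 1)
    exact tendsto_of_tendsto_of_tendsto_of_le_of_le' hlim tendsto_const_nhds hκsub
      (.of_forall fun n => MaxSliced.innerProb_le_one _)
  · refine MaxSliced.tendsto_one_of_forall_le (fun n => MaxSliced.innerProb_le_one _)
      fun δ hδ => ?_
    obtain ⟨R, hR⟩ := htight δ hδ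
    -- The bound on `η n` plays no role in this part; the value `1` is arbitrary.
    refine hprob (hR 1 one_pos) ?_
    filter_upwards [hreg R] with n hn ω hz hg _
    obtain ⟨h1, h2⟩ := hn ω hz hg
    exact ⟨h1.1, h1.2.1, h1.2.2.1, h2.1, h2.2.1, h2.2.2.1⟩
  · refine MaxSliced.tendsto_one_of_forall_le (fun n => MaxSliced.innerProb_le_one _)
      fun δ hδ => ?_
    obtain ⟨R, hR⟩ := htight δ hδ
    refine hprob (hR 1 one_pos) ?_
    have hr := MaxSliced.tendsto_const_div_const_mul_sqrt (2 * R + 1) (c / 2)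
    have h2r := hr.const_mul 2
    have hAr := h2r.const_mul ‖A‖
    rw [mul_zero] at h2r
    rw [mul_zero, mul_zero] at hAr
    filter_upwards [hreg R, h2r.eventually (gt_mem_nhds hε), hAr.eventually (gt_mem_nhds hε)]
      with n hn hn2 hnA ω hz hg _
    obtain ⟨h1, h2⟩ := hn ω hz hg
    exact ⟨(MaxSliced.hausdorffEDist_le_of_subset_closedBall h1.1 h2.1 h1.2.2.2
        h2.2.2.2).trans_lt ((ENNReal.ofReal_lt_ofReal_iff hε).mpr hn2),
      (MaxSliced.hausdorffEDist_linImage_le hAD h1.1 h2.1 h1.2.2.2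
        h2.2.2.2).trans_lt ((ENNReal.ofReal_lt_ofReal_iff hε).mpr hnA)⟩
  · obtain ⟨R, hR⟩ := htight δ hδ
    -- The constant is the diameter bound for the ball of the linearised problem, times `√n`. It is
    -- four times what the estimators need, namely `(2 * R + 1) / c`, which relies on `η n ω ≤ 1`.
    refine ⟨2 * ((2 * R + 1) / (c / 2)), hprob (hR 1 one_pos) ?_⟩
    filter_upwards [hreg R, hL.eventually_nearMin_subset_closedBall R, eventually_gt_atTop 0]
      with n hn hnM hn0 ω hz hg hηω
    have hs : 0 < √(n : ℝ) := Real.sqrt_pos.mpr (by exact_mod_cast hn0)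
    have hC : 2 * ((2 * (R : ℝ) + 1) / (c / 2)) / √(n : ℝ)
        = 2 * ((2 * R + 1) / (c / 2 * √(n : ℝ))) := by
      field_simp
    obtain ⟨h1, h2⟩ := hn ω hz hg
    refine ⟨((hM hn0 ω).trans (hnM _ _ hz hηω)).trans (Metric.closedBall_subset_closedBall ?_), ?_⟩
    · rw [hC, show 2 * ((2 * (R : ℝ) + 1) / (c / 2 * √(n : ℝ)))
        = 4 * ((2 * R + 1) / (c * √(n : ℝ))) by field_simp; ring]
      have : 0 ≤ (2 * (R : ℝ) + 1) / (c * √(n : ℝ)) := by positivity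
      linarith
    · rw [hC]
      exact MaxSliced.hausdorffEDist_le_of_subset_closedBall h1.1 h2.1 h1.2.2.2 h2.2.2.2
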